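/- Let $n\ge 1$, $\hat\kappa\ge 2$, and let $G$ be a bipartite graph with parts $V_o=\{o_1,\dots,o_n\}$ (orchestration qubits, linearly ordered) and $V_c$ (peer qubits, finite) such that every peer has one or two neighbours in $V_o$; every $o_i$ has exactly $2\hat\kappa$ neighbours; every peer with two neighbours (a bridge) is adjacent to exactly one consecutive pair $(o_j,o_{j+1})$; and each consecutive pair shares exactly $\hat\kappa$ bridges. (These are the generalized tree-like, GTL, graphs $(G,\hat\kappa)$.) *Measurements.* Starting with $G_0=G$, the qubits $o_1,\dots,o_n$ are measured in this order in the Pauli-$X$ basis, with arbitrary outcomes. The measurement of $o_i$ uses a support vertex $b_i$, any peer adjacent to $o_i$ in $G_{i-1}$; it acts by the manipulation operator $\mathbf M_{x,\pm}^{(o_i)}=\langle x,\pm|^{(o_i)}\otimes U_\pm^\dagger P_{x,\pm}^{(o_i)}$, where $U_+=(iY_{b_i})^{1/2}\prod_{k\in N_{o_i}\setminus(N_{b_i}\cup\{b_i\})}Z_k$ and $U_-=(-iY_{b_i})^{1/2}\prod_{k\in N_{b_i}\setminus(N_{o_i}\cup\{o_i\})}Z_k$ with neighbourhoods in $G_{i-1}$;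 the graph becomes $G_i=\tau_{b_i}(\tau_{o_i}(\tau_{b_i}(G_{i-1}))-o_i)$, with $\tau$ local complementation. Let $\mathbf O=\mathbf M^{(o_n)}\cdots\mathbf M^{(o_1)}$. *Sets.* For $i<n$ let $\mathcal R_i$ be the set of bridges shared by $o_i$ and $o_{i+1}$, and let $\mathcal R_n$ be the set of neighbours of $o_n$ that are not neighbours of $o_{n-1}$ (all neighbours if $n=1$). Let $N_i$ be the neighbourhood of $o_i$ in $G_{i-1}$ and $\mathcal L_i=N_i\setminus\mathcal R_i$. If $b_i\in\mathcal R_i$ (a right support), put $\Gamma_i=\mathcal L_i$ and $\bar{\mathcal S}_i=\mathcal R_i\setminus\{b_i\}$; otherwise (a left support) put $\Gamma_i=\mathcal R_i$ and $\bar{\mathcal S}_i=\mathcal L_i\setminus\{b_i\}$. The elements of $\Gamma_i$ are the rolled vertices, those of $\bar{\mathcal S}_i$ the non-support vertices. *Noise.* Each qubit $v$ is affected by a depolarizing channel $\mathcal D_v(\rho)=p_v\rho+\frac{1-p_v}{4}(\rho+X_v\rho X_v+Y_v\rho Y_v+Z_v\rho Z_v)$ with a real parameter $p_v$. In the Noisy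 Stabilizer Formalism it is represented on the graph state by the noise operators $Z_v^\alpha\prod_{k\in N_v}Z_k^\beta$, $\alpha,\beta\in\{0,1\}$, which are updated at the measurement of $a$ with support $b$, factor by factor, by the rules $Z_a\mapsto Z_b\prod_{k\in N_b\setminus\{a\}}Z_k$, $Z_b\mapsto\prod_{k\in N'_b}Z_k$, and $Z_k\mapsto Z_k$ for the other $k$ ($N$ and $N'$ are the neighbourhoods before and after the measurement). If $\tilde\Lambda_{v,\alpha\beta}$ are the operators obtained after all $n$ measurements, the updated map is $\tilde{\mathcal D}_v(\varrho)=p_v\varrho+\frac{1-p_v}{4}\sum_{\alpha,\beta}\tilde\Lambda_{v,\alpha\beta}\,\varrho\,\tilde\Lambda_{v,\alpha\beta}$. **Proposition.** 1. For all outcomes, $\mathbf O|G\rangle\langle G|\mathbf O^\dagger=2^{-n}|G'\rangle\langle G'|$, where $G'$ is the graph induced by $G_n$ on $V_c$. The channels can be updated separately: for every finite list $v_1,\dots,v_r$ of qubits, $\mathbf O\,\bigl(\mathcal D_{v_1}\cdots\mathcal D_{v_r}(|G\rangle\langle G|)\bigr)\,\mathbf O^\dagger=\tilde{\mathcal D}_{v_1}\cdots\tilde{\mathcal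 D}_{v_r}\bigl(\mathbf O|G\rangle\langle G|\mathbf O^\dagger\bigr)$. 2. Every peer qubit $c$ is a support vertex $b_m$, or in $\Gamma_n$, or in some $\bar{\mathcal S}_m$, and $$\tilde{\mathcal D}_c(\varrho)=p_c\varrho+\tfrac{1-p_c}{4}\Bigl[\varrho+Z_c\varrho Z_c+\bigl(\textstyle\prod_{k\in\tilde N}Z_k\bigr)\varrho\bigl(\prod_{k\in\tilde N}Z_k\bigr)+\bigl(Z_c\prod_{k\in\tilde N}Z_k\bigr)\varrho\bigl(Z_c\prod_{k\in\tilde N}Z_k\bigr)\Bigr],$$ where $\tilde N=\Gamma_n\cup\bar{\mathcal S}_m$ if $c=b_m$; $\tilde N=\{b_1,\dots,b_n\}$ if $c\in\Gamma_n$; $\tilde N=\{b_m\}$ if $c\in\bar{\mathcal S}_m$. 3. For every orchestration qubit $o_i$, $$\tilde{\mathcal D}_{o_i}(\varrho)=p_{o_i}\varrho+\tfrac{1-p_{o_i}}{2}\bigl[\varrho+W_i\,\varrho\,W_i\bigr],$$ where $W_i=Z_{b_i}\prod_{\ell>i}Z_{b_\ell}$ if $b_\ell$ is a right support for every $\ell\ge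 i$; otherwise, if $m\ge i$ is the least index for which $b_m$ is a left support, $W_i=Z_{b_m}\prod_{\ell<i}Z_{b_\ell}$. -/

import Mathlib

namespace NoisyGTL

open Matrix Finset

noncomputable section

/-! ### Qubit registers, Pauli operators, graph states, depolarizing noise -/

/-- Computational basis labels of a register with one qubit per element of `W`. -/
abbrev Reg (W : Type*) := W → Fin 2

/-- Operators on the register (density operators in particular). -/
abbrev Op (W : Type*) := Matrix (Reg W) (Reg W) ℂ

/-- The one-qubit operator `A` acting on qubit `v`, tensored with the identity elsewhere. -/
def localOp {W : Type*} [Fintype W] [DecidableEq W] (v : W) (A : Matrix (Fin 2) (Fin 2) ℂ) : Op W :=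
  Matrix.of fun x y => if ∀ w, w ≠ v → x w = y w then A (x v) (y v) else 0

def pauliX : Matrix (Fin 2) (Fin 2) ℂ := !![0, 1; 1, 0]

def pauliY : Matrix (Fin 2) (Fin 2) ℂ := !![0, -Complex.I; Complex.I, 0]

def pauliZ : Matrix (Fin 2) (Fin 2) ℂ := !![1, 0; 0, -1]

/-- The Pauli-`Z` string `∏_{k ∈ S} Z_k`. -/
def zOp {W : Type*} [Fintype W] [DecidableEq W] (S : Finset W) : Op W :=
  Matrix.diagonal fun x => ∏ k ∈ S, (-1 : ℂ) ^ (x k : ℕ)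

open Classical in
/-- The graph state vector: a controlled-`Z` gate along every edge, applied to `|+⟩` on every qubit.
Each edge whose two end points are both in state `1` contributes a factor `-1`. -/
def graphVec {W : Type*} [Fintype W] (H : SimpleGraph W) : Reg W → ℂ := fun x =>
  ((Real.sqrt 2 : ℂ)⁻¹) ^ Fintype.card W *
    (-1 : ℂ) ^ (Finset.univ.filter fun e : Sym2 W => e ∈ H.edgeSet ∧ ∀ v ∈ e, x v = 1).card

/-- The graph state `|H⟩⟨H|`. -/
def graphState {W : Type*} [Fintype W] (H : SimpleGraph W) : Op W :=
  Matrix.vecMulVec (graphVec H) (star (graphVec H))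

/-- The single-qubit depolarizing channel on qubit `v` with parameter `p`. -/
def depol {W : Type*} [Fintype W] [DecidableEq W] (v : W) (p : ℝ) (ρ : Op W) : Op W :=
  (p : ℂ) • ρ + ((1 - p : ℂ) / 4) •
    (ρ + localOp v pauliX * ρ * localOp v pauliX + localOp v pauliY * ρ * localOp v pauliY
      + localOp v pauliZ * ρ * localOp v pauliZ)

/-! ### Graph operations -/

open Classical in
/-- The neighbourhood of `v`. -/
def nbrs {W : Type*} [Fintype W] (H : SimpleGraph W) (v : W) : Finset W :=
  Finset.univ.filter fun w => H.Adj v w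

/-- Local complementation `τ_a`: the edges inside the neighbourhood of `a` are complemented. -/
def localComp {W : Type*} (H : SimpleGraph W) (a : W) : SimpleGraph W where
  Adj u v := u ≠ v ∧ Xor (H.Adj u v) (H.Adj a u ∧ H.Adj a v)
  symm := ⟨by
    rintro u v ⟨h, h'⟩
    refine ⟨h.symm, ?_⟩
    rw [H.adj_comm v u, and_comm]
    exact h'⟩
  loopless := ⟨fun _ h => h.1 rfl⟩

/-- The graph after a Pauli-`X` measurement of `a` with support vertex `b`:
`τ_b (τ_a (τ_b H) - a)`. The measured vertex stays in the vertex type as an isolated vertex. -/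
def xMeasureGraph {W : Type*} (H : SimpleGraph W) (a b : W) : SimpleGraph W :=
  localComp ((localComp (localComp H b) a).deleteIncidenceSet a) b

/-! ### Pauli-`X` measurement operators -/

/-- The projector `|x,±⟩⟨x,±|`; the outcome `s = 0` is `+` and `s = 1` is `-`. -/
def xProj (s : Fin 2) : Matrix (Fin 2) (Fin 2) ℂ :=
  !![1 / 2, (-1) ^ (s : ℕ) / 2; (-1) ^ (s : ℕ) / 2, 1 / 2]

/-- The local correction attached to the measurement of `a` in the `X` basis on `|H⟩` with
support vertex `b`: `(iY_b)^{1/2} ∏_{k ∈ N_a \ (N_b ∪ {b})} Z_k` for the outcome `+` and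
`(-iY_b)^{1/2} ∏_{k ∈ N_b \ (N_a ∪ {a})} Z_k` for the outcome `-`,
where `(±iY)^{1/2} = (1 ± iY)/√2`. -/
def xCorrection {W : Type*} [Fintype W] [DecidableEq W] (H : SimpleGraph W) (a b : W) (s : Fin 2) :
    Op W :=
  localOp b (((Real.sqrt 2 : ℂ)⁻¹) • (1 + ((-1 : ℂ) ^ (s : ℕ) * Complex.I) • pauliY)) *
    zOp (if s = 0 then nbrs H a \ (nbrs H b ∪ {b}) else nbrs H b \ (nbrs H a ∪ {a}))

/-- The measurement operator `U† P` of `a` on `|H⟩`, before the measured qubit is discarded. -/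
def xMeasureOp {W : Type*} [Fintype W] [DecidableEq W] (H : SimpleGraph W) (a b : W) (s : Fin 2) :
    Op W :=
  (xCorrection H a b s)ᴴ * localOp a (xProj s)

/-! ### Generalized tree-like graphs

The orchestration qubits are `Sum.inl i` with `i : Fin n`, in their linear order; the peer qubits
are `Sum.inr c` with `c : C`. -/

section GTL

variable {n : ℕ} {C : Type*} [Fintype C]

open Classical in
/-- The peer neighbours of the orchestration qubit `o_i`. -/
def peerNbrs (H : SimpleGraph (Fin n ⊕ C)) (i : Fin n) : Finset C :=
  Finset.univ.filter fun c => H.Adj (Sum.inl i) (Sum.inr c)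

open Classical in
/-- The rank of a peer qubit: its number of orchestration neighbours. -/
def peerRank (H : SimpleGraph (Fin n ⊕ C)) (c : C) : ℕ :=
  (Finset.univ.filter fun i : Fin n => H.Adj (Sum.inl i) (Sum.inr c)).card

/-- `G` is the graph of a generalized tree-like state with peer degree `κc` and minimum bridge
degree `κ`. Bridges, the peers of rank larger than one, all have rank two. -/
structure IsGTL (G : SimpleGraph (Fin n ⊕ C)) (κc κ : ℕ) : Prop where
  not_adj_orch : ∀ i j : Fin n, ¬ G.Adj (Sum.inl i) (Sum.inl j)
  not_adj_peer : ∀ c d : C, ¬ G.Adj (Sum.inr c) (Sum.inr d)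
  rank_mem : ∀ c : C, peerRank G c = 1 ∨ peerRank G c = 2
  peer_degree : ∀ i : Fin n, (peerNbrs G i).card = κc
  bridge_order : ∀ c : C, peerRank G c = 2 →
    ∃! ij : Fin n × Fin n, (ij.1 : ℕ) + 1 = ij.2 ∧
      G.Adj (Sum.inl ij.1) (Sum.inr c) ∧ G.Adj (Sum.inl ij.2) (Sum.inr c)
  bridge_regular : ∀ i j : Fin n, (i : ℕ) + 1 = j →
    {c : C | peerRank G c = 2 ∧ G.Adj (Sum.inl i) (Sum.inr c) ∧
      G.Adj (Sum.inl j) (Sum.inr c)}.ncard = κ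

open Classical in
/-- The right neighbourhood of `o_i`: the bridges shared with `o_{i+1}`, and for the last
orchestration qubit its peers that are not shared with the previous one. -/
def rightSet (G : SimpleGraph (Fin n ⊕ C)) (i : Fin n) : Finset C :=
  (peerNbrs G i).filter fun c =>
    (∃ j : Fin n, (j : ℕ) = i + 1 ∧ G.Adj (Sum.inl j) (Sum.inr c)) ∨
      ((i : ℕ) + 1 = n ∧ ∀ j : Fin n, (j : ℕ) + 1 = i → ¬ G.Adj (Sum.inl j) (Sum.inr c))

/-! ### The rolling sequence, with support vertices `b` -/

/-- The graph after `o_1, …, o_t` have been measured. -/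
def rollGraph (G : SimpleGraph (Fin n ⊕ C)) (b : Fin n → C) : ℕ → SimpleGraph (Fin n ⊕ C)
  | 0 => G
  | t + 1 =>
    if h : t < n then
      xMeasureGraph (rollGraph G b t) (Sum.inl ⟨t, h⟩) (Sum.inr (b ⟨t, h⟩))
    else rollGraph G b t

/-- The graph on the peer qubits after all orchestration qubits have been measured. -/
def finalGraph (G : SimpleGraph (Fin n ⊕ C)) (b : Fin n → C) : SimpleGraph C :=
  (rollGraph G b n).comap Sum.inr

/-- The neighbourhood of `o_i` at the moment at which it is measured. -/
def currentNbrs (G : SimpleGraph (Fin n ⊕ C)) (b : Fin n → C) (i : Fin n) : Finset C :=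
  peerNbrs (rollGraph G b i) i

/-- Each support vertex is a peer adjacent to `o_i` when `o_i` is measured. It may be taken on the
right (in `rightSet G i`) or on the left (in the rest of the current neighbourhood), freely at each
step. -/
def IsSupportSequence (G : SimpleGraph (Fin n ⊕ C)) (b : Fin n → C) : Prop :=
  ∀ i : Fin n, b i ∈ currentNbrs G b i

variable [DecidableEq C]

/-- The rolled vertices of step `i`: the current neighbours of `o_i` on the side that does not
contain the support vertex. -/
def rolledSet (G : SimpleGraph (Fin n ⊕ C)) (b : Fin n → C) (i : Fin n) : Finset C :=
  if b i ∈ rightSet G i then currentNbrs G b i \ rightSet G i else rightSet G i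

/-- The non-support vertices of step `i`: the current neighbours of `o_i`, other than the support
vertex, on the side that contains the support vertex. -/
def nonSupport (G : SimpleGraph (Fin n ⊕ C)) (b : Fin n → C) (i : Fin n) : Finset C :=
  (if b i ∈ rightSet G i then rightSet G i else currentNbrs G b i \ rightSet G i) \ {b i}

/-- `U†P` for `o_1`, …, `o_t`, with outcomes `s`, in this order. -/
def seqOp (G : SimpleGraph (Fin n ⊕ C)) (b : Fin n → C) (s : Fin n → Fin 2) : ℕ → Op (Fin n ⊕ C)
  | 0 => 1
  | t + 1 =>
    if h : t < n then
      xMeasureOp (rollGraph G b t) (Sum.inl ⟨t, h⟩) (Sum.inr (b ⟨t, h⟩)) (s ⟨t, h⟩) *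
        seqOp G b s t
    else seqOp G b s t

/-- The operator `⨂_i ⟨x, s_i|` on the orchestration qubits, tensored with the identity on the
peer qubits. -/
def discardOp (s : Fin n → Fin 2) : Matrix (Reg C) (Reg (Fin n ⊕ C)) ℂ :=
  Matrix.of fun y x =>
    if ∀ c, x (Sum.inr c) = y c then
      ∏ i : Fin n, (Real.sqrt 2 : ℂ)⁻¹ * (-1 : ℂ) ^ ((s i : ℕ) * (x (Sum.inl i) : ℕ))
    else 0

/-- The manipulation operator of the whole measurement sequence, from all qubits to the peer qubits.
No step acts on an orchestration qubit that was measured before it, so that the measured qubits may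
all be discarded at the end. -/
def rollOp (G : SimpleGraph (Fin n ⊕ C)) (b : Fin n → C) (s : Fin n → Fin 2) :
    Matrix (Reg C) (Reg (Fin n ⊕ C)) ℂ :=
  discardOp s * seqOp G b s n

/-! ### The noisy stabilizer formalism

A noise operator is a `Z` string, given by the finite set of the qubits it acts on; the product of
two strings is the symmetric difference. -/

/-- Update of a `Z` string under a Pauli-`X` measurement of `a` on `|H⟩` with support vertex `b`,
factor by factor: `Z_a ↦ Z_b ∏_{k ∈ N_b \ {a}} Z_k`, `Z_b ↦ ∏_{k ∈ N'_b} Z_k`, and `Z_k ↦ Z_k`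
otherwise, `N'` being the neighbourhood after the measurement. On `Z_j^α ∏_{k ∈ N_j} Z_k^β` this gives
`Z_b^α ∏_{k ∈ N_b \ {a}} Z_k^α` for `j = a`, `Z_b^β ∏_{k ∈ N'_b} Z_k^α` for `j = b`, and
`Z_j^α ∏_{k ∈ N'_j} Z_k^β` for the other qubits. -/
def nsfStep {W : Type*} [Fintype W] [DecidableEq W] (H : SimpleGraph W) (a b : W) (S : Finset W) :
    Finset W :=
  symmDiff (S \ {a, b})
    (symmDiff (if a ∈ S then insert b (nbrs H b \ {a}) else ∅)
      (if b ∈ S then nbrs (xMeasureGraph H a b) b else ∅))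

/-- The noise operator of qubit `v` with exponents `α` and `β`, namely `Z_v^α ∏_{k ∈ N_v} Z_k^β`
before any measurement, updated through the measurements of `o_1, …, o_t`. -/
def nsfString (G : SimpleGraph (Fin n ⊕ C)) (b : Fin n → C) (v : Fin n ⊕ C) (α β : Bool) :
    ℕ → Finset (Fin n ⊕ C)
  | 0 => symmDiff (if α then {v} else ∅) (if β then nbrs G v else ∅)
  | t + 1 =>
    if h : t < n then
      nsfStep (rollGraph G b t) (Sum.inl ⟨t, h⟩) (Sum.inr (b ⟨t, h⟩)) (nsfString G b v α β t)
    else nsfString G b v α β t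

/-- The fully updated noise operator of qubit `v`, acting on the peer qubits. -/
def updatedNoiseOp (G : SimpleGraph (Fin n ⊕ C)) (b : Fin n → C) (v : Fin n ⊕ C) (α β : Bool) :
    Op C :=
  zOp (nsfString G b v α β n).toRight

/-- The updated depolarizing map of qubit `v`. -/
def updatedMap (G : SimpleGraph (Fin n ⊕ C)) (b : Fin n → C) (v : Fin n ⊕ C) (p : ℝ) (ρ : Op C) :
    Op C :=
  (p : ℂ) • ρ + ((1 - p : ℂ) / 4) •
    ∑ α : Bool, ∑ β : Bool, updatedNoiseOp G b v α β * ρ * updatedNoiseOp G b v α β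

end GTL

/-- The mixture of `1`, `Z_c`, `∏_{k ∈ N} Z_k` and `Z_c ∏_{k ∈ N} Z_k`. -/
def peerMixture {C : Type*} [Fintype C] [DecidableEq C] (c : C) (N : Finset C) (p : ℝ) (ρ : Op C) :
    Op C :=
  (p : ℂ) • ρ + ((1 - p : ℂ) / 4) •
    (ρ + zOp {c} * ρ * zOp {c} + zOp N * ρ * zOp N + (zOp {c} * zOp N) * ρ * (zOp {c} * zOp N))

/-- The mixture of `1` and `Z_c ∏_{k ∈ N} Z_k`. -/
def orchMixture {C : Type*} [Fintype C] [DecidableEq C] (c : C) (N : Finset C) (p : ℝ) (ρ : Op C) :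
    Op C :=
  (p : ℂ) • ρ + ((1 - p : ℂ) / 2) • (ρ + (zOp {c} * zOp N) * ρ * (zOp {c} * zOp N))

end

end NoisyGTL

open NoisyGTL Matrix

/-!
The proof separates linear algebra over `ZMod 2` from the combinatorics of the rolling sequence.

*Quantum part.* A graph state vector with a `Z` string on it has amplitude `2^(-|W|/2) (-1)^q(x)`,
where `q` is the sum of a linear form (`linForm`) and of the quadratic form that counts edges
(`edgeForm`). The graph operation `τ_b τ_a τ_b` changes the quadratic form by a product of two
linear forms (`edgeForm_xMeasureGraph`). After summing out the labels of the measured and of the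
support qubit, this product is what the measurement produces, so that one step acts on these
vectors by the string update `nsfStep`, up to a sign and the amplitude `1/√2`
(`xMeasureOp_mulVec_stringVec`). Iterating gives `rollOp_mulVec_stringVec`. A Pauli operator acts
on such a vector as a `Z` string, up to a phase, so a depolarizing channel is a mixture of `Z`
strings on the span of these states; the string update is additive, and the channels can be
updated one at a time (`rollMap_foldr_depol`).

*Noise operators.* At a measurement step the operators `Z_v^α ∏_{k ∈ N_v} Z_k^β` keep their form
on the new graph, with the exponents exchanged for the support vertex. Since the sum over the
exponents is symmetric, a peer qubit ends with the noise of its final neighbourhood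
(`updatedMap_inr`), and an orchestration qubit with a mixture of the identity and one string
(`updatedMap_inl`).

*Combinatorics.* The peers of a tree-like graph have levels along the chain (`IsLevel`). During
the sequence each peer has one of four roles (`Role`), and all edges of the current graph are
determined by roles and levels (`RollShape`): a support vertex is joined to the currently rolled
vertices and to the non-support vertices of its own step. `rollShape_succ` shows that a
measurement preserves this shape. The final neighbourhoods, and the path of the noise of an
orchestration qubit along the right supports up to the first left support, are read off from it.
-/

namespace NoisyGTL

open Matrix Finset

noncomputable section

/-! ### Signs with exponents in `ZMod 2` -/

/-- The integer sign `(-1)^z` for an exponent modulo two. -/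
def intSign (z : ZMod 2) : ℤ := if z = 0 then 1 else -1

/-- The complex sign `(-1)^z` for an exponent modulo two. -/
def sgn (z : ZMod 2) : ℂ := (intSign z : ℤ)

lemma intSign_add : ∀ y z : ZMod 2, intSign (y + z) = intSign y * intSign z := by decide

lemma sgn_add (y z : ZMod 2) : sgn (y + z) = sgn y * sgn z := by
  simp [sgn, intSign_add]

@[simp] lemma sgn_zero : sgn 0 = 1 := by simp [sgn, intSign]

@[simp] lemma sgn_one : sgn 1 = -1 := by simp [sgn, intSign]

lemma sgn_mul_self (z : ZMod 2) : sgn z * sgn z = 1 := by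
  rw [← sgn_add, CharTwo.add_self_eq_zero, sgn_zero]

lemma sgn_natCast (k : ℕ) : sgn (k : ZMod 2) = (-1) ^ k := by
  induction k with
  | zero => simp
  | succ k ih => rw [Nat.cast_succ, sgn_add, ih, sgn_one, pow_succ]

lemma sgn_sum {ι : Type*} (S : Finset ι) (f : ι → ZMod 2) :
    sgn (∑ i ∈ S, f i) = ∏ i ∈ S, sgn (f i) := by
  classical
  induction S using Finset.induction_on with
  | empty => simp
  | insert i S hi ih => rw [sum_insert hi, prod_insert hi, sgn_add, ih]

@[simp] lemma star_sgn (z : ZMod 2) : star (sgn z) = sgn z := by simp [sgn]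

/-- The value of a qubit label as an exponent modulo two. -/
def bit (z : Fin 2) : ZMod 2 := (z : ℕ)

@[simp] lemma bit_zero : bit 0 = 0 := rfl

@[simp] lemma bit_one : bit 1 = 1 := rfl

/-! ### `Z` strings and graph states as sign functions -/

section Forms

variable {W : Type*}

/-- The exponent of the sign by which the `Z` string on `S` multiplies the basis state `x`. -/
def linForm (S : Finset W) (x : Reg W) : ZMod 2 := ∑ k ∈ S, bit (x k)

@[simp] lemma linForm_empty (x : Reg W) : linForm ∅ x = 0 := sum_empty

@[simp] lemma linForm_singleton (v : W) (x : Reg W) : linForm {v} x = bit (x v) :=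
  sum_singleton _ _

/-- The entry of the adjacency matrix modulo two. -/
def adjBit (H : SimpleGraph W) (u v : W) : ZMod 2 := by
  classical exact if H.Adj u v then 1 else 0

lemma adjBit_eq (H : SimpleGraph W) (u v : W) [Decidable (H.Adj u v)] :
    adjBit H u v = if H.Adj u v then 1 else 0 := by
  unfold adjBit
  congr

lemma adjBit_comm (H : SimpleGraph W) (u v : W) : adjBit H u v = adjBit H v u := by
  classical simp only [adjBit_eq, H.adj_comm]

@[simp] lemma adjBit_self (H : SimpleGraph W) (u : W) : adjBit H u u = 0 := by
  classical simp [adjBit_eq]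

variable [Fintype W]

lemma linForm_eq_sum_ite [DecidableEq W] (S : Finset W) (x : Reg W) :
    linForm S x = ∑ k, if k ∈ S then bit (x k) else 0 := by
  simp [linForm]

lemma linForm_symmDiff [DecidableEq W] (S T : Finset W) (x : Reg W) :
    linForm (symmDiff S T) x = linForm S x + linForm T x := by
  simp only [linForm_eq_sum_ite, ← sum_add_distrib]
  refine sum_congr rfl fun k _ => ?_
  by_cases hS : k ∈ S <;> by_cases hT : k ∈ T <;>
    simp [mem_symmDiff, hS, hT, CharTwo.add_self_eq_zero]

lemma linForm_update [DecidableEq W] (S : Finset W) (x : Reg W) (v : W) (j : Fin 2) :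
    linForm S (Function.update x v j) =
      linForm S x + if v ∈ S then bit j + bit (x v) else 0 := by
  have h : (if v ∈ S then bit j + bit (x v) else 0) =
      ∑ k, if k = v then (if k ∈ S then bit j + bit (x k) else 0) else 0 := by simp
  rw [h]
  simp only [linForm_eq_sum_ite, ← sum_add_distrib]
  refine sum_congr rfl fun k _ => ?_
  by_cases hk : k = v
  · subst hk
    by_cases hS : k ∈ S
    · simp only [hS, Function.update_self, if_true]
      rw [add_left_comm, CharTwo.add_self_eq_zero, add_zero]
    · simp [hS]
  · simp [hk]

lemma zOp_eq [DecidableEq W] (S : Finset W) :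
    zOp S = Matrix.diagonal fun x => sgn (linForm S x) := by
  unfold zOp linForm bit
  simp only [sgn_sum, sgn_natCast]

lemma zOp_mul [DecidableEq W] (S T : Finset W) : zOp S * zOp T = zOp (symmDiff S T) := by
  simp only [zOp_eq, diagonal_mul_diagonal, linForm_symmDiff, sgn_add]

@[simp] lemma zOp_empty [DecidableEq W] : zOp (∅ : Finset W) = 1 := by
  simp [zOp_eq]

@[simp] lemma conjTranspose_zOp [DecidableEq W] (S : Finset W) : (zOp S)ᴴ = zOp S := by
  rw [zOp_eq, diagonal_conjTranspose]
  congr 1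
  funext x
  simp

@[simp] lemma mem_nbrs {H : SimpleGraph W} {u v : W} : v ∈ nbrs H u ↔ H.Adj u v := by
  simp [nbrs]

lemma linForm_nbrs (H : SimpleGraph W) (v : W) (x : Reg W) :
    linForm (nbrs H v) x = ∑ k, adjBit H v k * bit (x k) := by
  classical
  simp [linForm_eq_sum_ite, adjBit_eq]

open Classical in
/-- The parity of the number of edges of `H` with both ends in state `1`. -/
def edgeForm (H : SimpleGraph W) (x : Reg W) : ZMod 2 :=
  ((Finset.univ.filter fun e : Sym2 W => e ∈ H.edgeSet ∧ ∀ v ∈ e, x v = 1).card : ℕ)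

lemma graphVec_eq (H : SimpleGraph W) (x : Reg W) :
    graphVec H x = ((Real.sqrt 2 : ℂ)⁻¹) ^ Fintype.card W * sgn (edgeForm H x) := by
  rw [edgeForm, sgn_natCast]
  rfl

lemma bit_eq_ite (z : Fin 2) : bit z = if z = 1 then 1 else 0 := by
  revert z; decide

lemma edgeForm_eq_sum_lt [LinearOrder W] (H : SimpleGraph W) (x : Reg W) :
    edgeForm H x =
      ∑ u, ∑ v, if u < v then adjBit H u v * (bit (x u) * bit (x v)) else 0 := by
  classical
  let p : Sym2 W → ZMod 2 := fun e => if e ∈ H.edgeSet ∧ ∀ v ∈ e, x v = 1 then 1 else 0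
  have h1 : edgeForm H x = ∑ e : Sym2 W, p e := by
    simp only [edgeForm, p, Finset.sum_boole]
    congr!
  have h2 : ∑ e : Sym2 W, p e = ∑ e ∈ (univ : Finset W).sym2 with ¬ e.IsDiag, p e := by
    rw [sum_filter, sym2_univ]
    refine sum_congr (by congr!) fun e _ => ?_
    by_cases he : e.IsDiag
    · simp only [he, not_true_eq_false, if_false, p]
      rw [if_neg]
      exact fun h => H.not_isDiag_of_mem_edgeSet h.1 he
    · simp [he]
  rw [h1, h2, sum_sym2_filter_not_isDiag, sum_filter]
  have h3 : (univ : Finset W).offDiag = univ.filter fun q : W × W => q.1 ≠ q.2 := by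
    ext q; simp
  rw [h3, sum_filter, ← univ_product_univ, sum_product]
  refine sum_congr rfl fun u _ => sum_congr rfl fun v _ => ?_
  by_cases huv : u < v
  · simp only [huv, huv.ne, ne_eq, not_false_eq_true, if_true, p, adjBit_eq, bit_eq_ite]
    by_cases h : H.Adj u v <;> by_cases hu : x u = 1 <;> by_cases hv : x v = 1 <;>
      simp [h, hu, hv]
  · simp [huv]

/-- The symmetrized sum over the pairs `u < v` is the sum over all ordered pairs without the diagonal;
modulo two, the diagonal is subtracted by adding it. -/
lemma sum_lt_add_swap [LinearOrder W] (w : W → W → ZMod 2) :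
    (∑ u, ∑ v, if u < v then w u v + w v u else 0) = ∑ u, ∑ v, w u v + ∑ u, w u u := by
  have h1 : (∑ u, ∑ v, if u < v then w u v + w v u else 0) =
      (∑ u, ∑ v, if u < v then w u v else 0) + ∑ u, ∑ v, if v < u then w u v else 0 := by
    rw [sum_comm (f := fun u v => if v < u then w u v else 0)]
    simp only [← sum_add_distrib]
    refine sum_congr rfl fun u _ => sum_congr rfl fun v _ => ?_
    split_ifs <;> simp
  have h2 : (∑ u, w u u) = ∑ u, ∑ v, if u = v then w u v else 0 := by simp
  rw [h1, h2]
  simp only [← sum_add_distrib]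
  refine sum_congr rfl fun u _ => sum_congr rfl fun v _ => ?_
  rcases lt_trichotomy u v with h | h | h
  · simp [h, h.not_gt, h.ne]
  · subst h; simp [CharTwo.add_self_eq_zero]
  · simp [h, h.not_gt, h.ne']

/-- Changing the label of one vertex changes the edge form by the parity of its neighbours. -/
lemma edgeForm_update [DecidableEq W] (H : SimpleGraph W) (x : Reg W) (v : W) (j : Fin 2) :
    edgeForm H (Function.update x v j) =
      edgeForm H x + (bit j + bit (x v)) * linForm (nbrs H v) x := by
  let _ : LinearOrder W := by
    classical exact LinearOrder.lift' (Fintype.equivFin W) (Fintype.equivFin W).injective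
  set d := bit j + bit (x v) with hd
  have hb : ∀ u, bit (Function.update x v j u) = bit (x u) + if u = v then d else 0 := by
    intro u
    by_cases hu : u = v
    · subst hu
      simp only [Function.update_self, if_true, hd]
      rw [add_left_comm, CharTwo.add_self_eq_zero, add_zero]
    · simp [hu]
  have key := sum_lt_add_swap (W := W)
    fun u w => adjBit H u w * ((if u = v then d else 0) * bit (x w))
  have hdiag : ∑ u, adjBit H u u * ((if u = v then d else 0) * bit (x u)) = 0 := by simp
  have hfull : ∑ u, ∑ w, adjBit H u w * ((if u = v then d else 0) * bit (x w)) =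
      d * linForm (nbrs H v) x := by
    rw [linForm_nbrs, mul_sum, sum_eq_single v]
    · refine sum_congr rfl fun w _ => ?_
      simp; ring
    · intro u _ hu
      simp [hu]
    · simp
  rw [hdiag, hfull, add_zero] at key
  rw [← key, edgeForm_eq_sum_lt, edgeForm_eq_sum_lt]
  simp only [← sum_add_distrib]
  refine sum_congr rfl fun u _ => sum_congr rfl fun w _ => ?_
  by_cases huw : u < w
  · simp only [huw, if_true, hb, adjBit_comm H w u]
    by_cases hu : u = v
    · have hw : w ≠ v := fun h => huw.ne (hu.trans h.symm)
      simp [hu, hw]; ring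
    · by_cases hw : w = v <;> simp [hu, hw]; ring
  · simp [huw]

end Forms

/-! ### The graph after a Pauli-`X` measurement -/

section MeasureGraph

variable {W : Type*} {H : SimpleGraph W} {a b : W}

lemma localComp_adj {u v : W} :
    (localComp H a).Adj u v ↔ u ≠ v ∧ Xor (H.Adj u v) (H.Adj a u ∧ H.Adj a v) := Iff.rfl

lemma not_xMeasureGraph_adj_left (v : W) : ¬ (xMeasureGraph H a b).Adj a v := by
  classical
  simp [xMeasureGraph, localComp_adj, SimpleGraph.deleteIncidenceSet_adj, Xor]

/-- The support vertex takes over the neighbourhood of the measured vertex. -/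
lemma xMeasureGraph_adj_support (hab : H.Adj a b) (v : W) :
    (xMeasureGraph H a b).Adj b v ↔ H.Adj a v ∧ v ≠ b := by
  classical
  have hba := hab.symm
  have hne := hab.ne
  by_cases hva : v = a
  · subst hva
    have := not_xMeasureGraph_adj_left (H := H) (a := v) (b := b) b
    rw [SimpleGraph.adj_comm] at this
    simp [this]
  by_cases hvb : v = b
  · subst hvb; simp
  simp [xMeasureGraph, localComp_adj, SimpleGraph.deleteIncidenceSet_adj, xor_def, hab, hba, hne,
    hne.symm, hva, hvb, Ne.symm hva, Ne.symm hvb]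
  tauto

/-- Away from the measured vertex and the support vertex, the edges between their two
neighbourhoods are complemented. -/
lemma xMeasureGraph_adj_of_ne (hab : H.Adj a b) {u v : W} (hua : u ≠ a) (hub : u ≠ b) (hva : v ≠ a)
    (hvb : v ≠ b) (huv : u ≠ v) :
    (xMeasureGraph H a b).Adj u v ↔
      Xor (H.Adj u v) (Xor (H.Adj a u ∧ H.Adj b v) (H.Adj b u ∧ H.Adj a v)) := by
  classical
  have hba := hab.symm
  have hne := hab.ne
  simp [xMeasureGraph, localComp_adj, SimpleGraph.deleteIncidenceSet_adj, xor_def, hab, hba, hne,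
    hne.symm, hva, Ne.symm hva, Ne.symm hvb, hua, Ne.symm hua, Ne.symm hub, huv]
  by_cases h1 : H.Adj u v <;> by_cases h2 : H.Adj a u <;> by_cases h3 : H.Adj a v <;>
    by_cases h4 : H.Adj b u <;> by_cases h5 : H.Adj b v <;> simp [h1, h2, h3, h4, h5]

end MeasureGraph

/-! ### One measurement step on a graph state with a `Z` string -/

section Step

variable {W : Type*} [Fintype W] [DecidableEq W] {H : SimpleGraph W} {a b : W}

lemma bit_mul_self (z : Fin 2) : bit z * bit z = bit z := by
  revert z; decide

/-- The edge form changes by a product of linear forms of the two neighbourhoods. That product is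
the sum over the complemented pairs, plus a diagonal term from the common neighbours and the support
vertex. -/
lemma edgeForm_xMeasureGraph (hab : H.Adj a b) (x : Reg W) :
    edgeForm (xMeasureGraph H a b) x = edgeForm H x +
      linForm (nbrs H a) x * (linForm (nbrs H b) x + bit (x b)) +
      linForm (nbrs H a ∩ nbrs H b) x + bit (x b) := by
  classical
  let _ : LinearOrder W := LinearOrder.lift' (Fintype.equivFin W) (Fintype.equivFin W).injective
  -- `γ` is the row of `b` with an additional entry at `b` itself.
  let γ : W → ZMod 2 := fun v => adjBit H b v + if v = b then 1 else 0
  have hprod : ∑ u, ∑ v, (adjBit H a u * bit (x u)) * (γ v * bit (x v)) =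
      linForm (nbrs H a) x * (linForm (nbrs H b) x + bit (x b)) := by
    rw [linForm_nbrs, linForm_nbrs, sum_mul]
    refine sum_congr rfl fun u _ => ?_
    rw [← mul_sum]
    congr 1
    simp [γ, add_mul, sum_add_distrib]
  have hdiag : ∑ u, (adjBit H a u * bit (x u)) * (γ u * bit (x u)) =
      linForm (nbrs H a ∩ nbrs H b) x + bit (x b) := by
    have hb : bit (x b) = ∑ u, if u = b then adjBit H a u * bit (x u) else 0 := by
      simp [adjBit_eq, hab]
    rw [hb, linForm_eq_sum_ite, ← sum_add_distrib]
    refine sum_congr rfl fun u _ => ?_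
    have : (adjBit H a u * bit (x u)) * (γ u * bit (x u)) =
        adjBit H a u * γ u * bit (x u) := by
      rw [mul_mul_mul_comm, bit_mul_self]
    rw [this]
    simp only [γ, adjBit_eq, mem_inter, mem_nbrs]
    by_cases hu : u = b
    · subst hu; simp
    · by_cases h1 : H.Adj a u <;> by_cases h2 : H.Adj b u <;> simp [hu, h1, h2]
  have key := sum_lt_add_swap (W := W)
    fun u v => (adjBit H a u * bit (x u)) * (γ v * bit (x v))
  rw [hprod, hdiag] at key
  rw [add_assoc, add_assoc, ← key, edgeForm_eq_sum_lt, edgeForm_eq_sum_lt]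
  simp only [← sum_add_distrib]
  refine sum_congr rfl fun u _ => sum_congr rfl fun v _ => ?_
  by_cases huv : u < v
  · have hne := huv.ne
    -- The change of the adjacency matrix is symmetric bilinear, also in the rows of `a` and `b`.
    have hadj : adjBit (xMeasureGraph H a b) u v =
        adjBit H u v + adjBit H a u * γ v + adjBit H a v * γ u := by
      have hn := hab.ne
      have hba := hab.symm
      have e0 : (1 + 1 : ZMod 2) = 0 := rfl
      by_cases hua : u = a
      · subst hua
        simp only [adjBit_eq, not_xMeasureGraph_adj_left, γ]
        by_cases hvb : v = b <;> by_cases h : H.Adj u v <;> simp_all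
      by_cases hva : v = a
      · subst hva
        simp only [adjBit_eq, SimpleGraph.adj_comm _ u v, not_xMeasureGraph_adj_left, γ]
        by_cases hub : u = b <;> by_cases h : H.Adj v u <;> simp_all
      by_cases hub : u = b
      · subst hub
        simp only [adjBit_eq, xMeasureGraph_adj_support hab, γ]
        by_cases h : H.Adj a v <;> by_cases h' : H.Adj u v <;> simp_all [Ne.symm hne]
      by_cases hvb : v = b
      · subst hvb
        simp only [adjBit_eq, SimpleGraph.adj_comm _ u v, xMeasureGraph_adj_support hab, γ]
        by_cases h : H.Adj a u <;> by_cases h' : H.Adj v u <;> simp_all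
      simp only [adjBit_eq, xMeasureGraph_adj_of_ne hab hua hub hva hvb hne, γ, xor_def]
      by_cases h1 : H.Adj u v <;> by_cases h2 : H.Adj a u <;> by_cases h3 : H.Adj a v <;>
        by_cases h4 : H.Adj b u <;> by_cases h5 : H.Adj b v <;>
        simp [h1, h2, h3, h4, h5, hub, hvb, e0]
    simp only [huv, if_true, hadj]
    ring
  · simp [huv]

/-- The graph state vector of `H` with the `Z` string on `S` applied to it. -/
def stringVec (H : SimpleGraph W) (S : Finset W) : Reg W → ℂ := zOp S *ᵥ graphVec H

lemma stringVec_apply (H : SimpleGraph W) (S : Finset W) (x : Reg W) :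
    stringVec H S x = ((Real.sqrt 2 : ℂ)⁻¹) ^ Fintype.card W *
      sgn (linForm S x + edgeForm H x) := by
  rw [stringVec, zOp_eq, mulVec_diagonal, graphVec_eq, sgn_add]
  ring

lemma zOp_mulVec_stringVec (H : SimpleGraph W) (S T : Finset W) :
    zOp T *ᵥ stringVec H S = stringVec H (symmDiff T S) := by
  rw [stringVec, stringVec, mulVec_mulVec, zOp_mul]

lemma localOp_mulVec (v : W) (A : Matrix (Fin 2) (Fin 2) ℂ) (ψ : Reg W → ℂ) (x : Reg W) :
    (localOp v A *ᵥ ψ) x = ∑ j, A (x v) j * ψ (Function.update x v j) := by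
  rw [mulVec, dotProduct]
  symm
  refine Fintype.sum_of_injective (fun j => Function.update x v j) ?_ _ _ ?_ ?_
  · intro i j h
    simpa using congrFun h v
  · intro y hy
    rw [localOp, of_apply, if_neg, zero_mul]
    intro h
    refine hy ⟨y v, ?_⟩
    funext w
    by_cases hw : w = v
    · subst hw; simp
    · simp [hw, h w hw]
  · intro j
    rw [localOp, of_apply, if_pos]
    · simp
    · intro w hw
      simp [hw]

lemma conjTranspose_localOp (v : W) (A : Matrix (Fin 2) (Fin 2) ℂ) :
    (localOp v A)ᴴ = localOp v Aᴴ := by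
  ext x y
  simp only [conjTranspose_apply, localOp, of_apply]
  by_cases h : ∀ w, w ≠ v → x w = y w
  · rw [if_pos h, if_pos fun w hw => (h w hw).symm]
  · rw [if_neg h, if_neg fun h' => h fun w hw => (h' w hw).symm, star_zero]

/-- The entry `(i, j)` of the adjoint of `(1 ± iY)/√2` is `1/√2` times the sign with this exponent;
the case `s = 0` belongs to the upper sign. -/
def correctionExp (s : Fin 2) (i j : Fin 2) : ZMod 2 :=
  if s = 0 then (1 + bit i) * bit j else bit i * (1 + bit j)

lemma conjTranspose_correction_apply (s i j : Fin 2) :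
    (((Real.sqrt 2 : ℂ)⁻¹) • (1 + ((-1 : ℂ) ^ (s : ℕ) * Complex.I) • pauliY))ᴴ i j =
      (Real.sqrt 2 : ℂ)⁻¹ * sgn (correctionExp s i j) := by
  fin_cases s <;> fin_cases i <;> fin_cases j <;>
    simp [pauliY, correctionExp, CharTwo.add_self_eq_zero]

lemma xProj_apply (s i j : Fin 2) : xProj s i j = 1 / 2 * sgn (bit s * (bit i + bit j)) := by
  fin_cases s <;> fin_cases i <;> fin_cases j <;>
    simp [xProj, CharTwo.add_self_eq_zero] <;> norm_num

/-- The finite sign identity behind one measurement step. The variables `p`, `r` are the labels of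
the measured qubit and of the support qubit, `A`, `B` the parities of their neighbourhoods, `A'`,
`B'` tell whether the string acts on them, and `s` is the outcome. -/
lemma sum_intSign_step : ∀ (s p r : Fin 2) (A B A' B' : ZMod 2),
    ∑ j : Fin 2, ∑ i : Fin 2,
      intSign (correctionExp s r j + bit s * (bit p + bit i) +
        (A' * (bit i + bit p) + B' * (bit j + bit r) +
        ((bit j + bit r) * B + (bit i + bit p) * (A + (bit j + bit r))))) =
    2 * intSign (A' * B' + (if s = 0 then A' else B') + A' * (bit r + B) + B' * (A + bit r) +
        B' * bit r + bit s * bit p + (if s = 0 then A + bit r else B + bit p) +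
        A * (B + bit r) + bit r) := by
  decide +kernel

lemma linForm_sdiff_pair (S : Finset W) (hab : a ≠ b) (x : Reg W) :
    linForm (S \ {a, b}) x = linForm S x + (if a ∈ S then bit (x a) else 0) +
      if b ∈ S then bit (x b) else 0 := by
  have ha : (if a ∈ S then bit (x a) else 0) =
      ∑ k, if k = a then (if k ∈ S then bit (x k) else 0) else 0 := by simp
  have hb : (if b ∈ S then bit (x b) else 0) =
      ∑ k, if k = b then (if k ∈ S then bit (x k) else 0) else 0 := by simp
  rw [ha, hb]
  simp only [linForm_eq_sum_ite, ← sum_add_distrib]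
  refine sum_congr rfl fun k _ => ?_
  by_cases hka : k = a
  · subst hka; simp [hab, CharTwo.add_self_eq_zero]
  · by_cases hkb : k = b
    · subst hkb; simp [Ne.symm hab, CharTwo.add_self_eq_zero]
    · simp [hka, hkb]

lemma nbrs_xMeasureGraph_support (hab : H.Adj a b) :
    nbrs (xMeasureGraph H a b) b = nbrs H a \ {b} := by
  ext v
  simp [xMeasureGraph_adj_support hab]

lemma linForm_sdiff_singleton (S : Finset W) {v : W} (hv : v ∈ S) (x : Reg W) :
    linForm (S \ {v}) x = linForm S x + bit (x v) := by
  have h : S \ {v} = symmDiff S {v} := by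
    ext u
    by_cases hu : u = v
    · subst hu; simp [mem_symmDiff, hv]
    · simp [mem_symmDiff, hu]
  rw [h, linForm_symmDiff, linForm_singleton]

lemma linForm_nsfStep (hab : H.Adj a b) (S : Finset W) (x : Reg W) :
    linForm (nsfStep H a b S) x = linForm S x +
      (if a ∈ S then 1 else 0) * (bit (x b) + linForm (nbrs H b) x) +
      (if b ∈ S then 1 else 0) * linForm (nbrs H a) x := by
  have h1 : linForm (insert b (nbrs H b \ {a})) x =
      bit (x b) + (linForm (nbrs H b) x + bit (x a)) := by
    rw [← linForm_sdiff_singleton _ (mem_nbrs.2 hab.symm)]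
    exact sum_insert (by simp)
  have h2 : linForm (nbrs (xMeasureGraph H a b) b) x = linForm (nbrs H a) x + bit (x b) := by
    rw [nbrs_xMeasureGraph_support hab, linForm_sdiff_singleton _ (mem_nbrs.2 hab)]
  have e2 : (2 : ZMod 2) = 0 := rfl
  rw [nsfStep, linForm_symmDiff, linForm_symmDiff, linForm_sdiff_pair S hab.ne]
  split_ifs <;> simp only [h1, h2, linForm_empty]
  · linear_combination (bit (x a) + bit (x b)) * e2
  · linear_combination (bit (x a)) * e2
  · linear_combination (bit (x b)) * e2
  · ring

/-- The exponent of the `Z` string in the local correction. -/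
lemma linForm_correction (hab : H.Adj a b) (s : Fin 2) (x : Reg W) :
    linForm (if s = 0 then nbrs H a \ (nbrs H b ∪ {b}) else nbrs H b \ (nbrs H a ∪ {a})) x =
      linForm (nbrs H a ∩ nbrs H b) x + if s = 0 then linForm (nbrs H a) x + bit (x b)
        else linForm (nbrs H b) x + bit (x a) := by
  have aux : ∀ {a b : W}, H.Adj a b → linForm (nbrs H a \ (nbrs H b ∪ {b})) x =
      linForm (nbrs H a ∩ nbrs H b) x + (linForm (nbrs H a) x + bit (x b)) := by
    intro a b hab
    rw [← linForm_sdiff_singleton _ (mem_nbrs.2 hab), ← linForm_symmDiff]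
    congr 1
    ext u
    simp only [mem_sdiff, mem_union, mem_symmDiff, mem_inter, mem_nbrs, mem_singleton]
    by_cases hu : u = b
    · subst hu; simp
    · tauto
  split_ifs
  · exact aux hab
  · rw [aux hab.symm, inter_comm]

/-- One measurement step on a graph state that carries a `Z` string: up to a sign and the amplitude
`1/√2`, the string is updated by the rules of the noisy stabilizer formalism. The outcome is
recorded by a `Z` on the measured qubit, which is isolated from then on. -/
lemma xMeasureOp_mulVec_stringVec (hab : H.Adj a b) (s : Fin 2) (S : Finset W) :
    ∃ e : ZMod 2, xMeasureOp H a b s *ᵥ stringVec H S =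
      (sgn e * (Real.sqrt 2 : ℂ)⁻¹) •
        stringVec (xMeasureGraph H a b)
          (symmDiff (nsfStep H a b S) (if s = 1 then {a} else ∅)) := by
  set A' : ZMod 2 := if a ∈ S then 1 else 0 with hA'
  set B' : ZMod 2 := if b ∈ S then 1 else 0 with hB'
  refine ⟨A' * B' + if s = 0 then A' else B', ?_⟩
  funext x
  have hne := hab.ne
  have hmem : ∀ (v : W) (z : ZMod 2), (if v ∈ S then z else 0) = (if v ∈ S then 1 else 0) * z := by
    intro v z; split_ifs <;> simp
  have hM : linForm (if s = 1 then {a} else ∅) x = bit s * bit (x a) := by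
    rcases Fin.exists_fin_two.1 ⟨s, rfl⟩ with h | h <;> subst h <;> simp
  have key := congrArg (fun z : ℤ => (z : ℂ)) (sum_intSign_step s (x a) (x b)
    (linForm (nbrs H a) x) (linForm (nbrs H b) x) A' B')
  simp only [Int.cast_sum, Int.cast_mul, Int.cast_ofNat] at key
  change ∑ j, ∑ i, sgn _ = 2 * sgn _ at key
  rw [xMeasureOp, xCorrection, conjTranspose_mul, conjTranspose_zOp, conjTranspose_localOp,
    ← mulVec_mulVec, ← mulVec_mulVec, zOp_eq, mulVec_diagonal, linForm_correction hab,
    localOp_mulVec]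
  simp only [localOp_mulVec, Pi.smul_apply, smul_eq_mul]
  have hterm : ∀ i j, stringVec H S (Function.update (Function.update x b j) a i) =
      ((Real.sqrt 2 : ℂ)⁻¹) ^ Fintype.card W * (sgn (linForm S x + edgeForm H x) *
      sgn (A' * (bit i + bit (x a)) + B' * (bit j + bit (x b)) +
        ((bit j + bit (x b)) * linForm (nbrs H b) x +
          (bit i + bit (x a)) * (linForm (nbrs H a) x + (bit j + bit (x b)))))) := by
    intro i j
    rw [stringVec_apply, ← sgn_add]
    congr 2
    rw [linForm_update, linForm_update, edgeForm_update, edgeForm_update, linForm_update,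
      if_pos (mem_nbrs.2 hab), Function.update_of_ne hne, hmem a, hmem b]
    ring
  have hP : ∀ j i, xProj s (Function.update x b j a) i =
      1 / 2 * sgn (bit s * (bit (x a) + bit i)) := by
    intro j i
    rw [xProj_apply, Function.update_of_ne hne]
  simp only [conjTranspose_correction_apply, hterm, hP]
  have hcollect : ∀ {y c q : ℂ} {e f g : ZMod 2},
      y * sgn e * (1 / 2 * sgn f * (c * (q * sgn g))) = y * c * q * (1 / 2) * sgn (e + f + g) := by
    intro y c q e f g
    rw [sgn_add, sgn_add]; ring
  simp only [mul_sum, hcollect]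
  simp only [← mul_sum]
  rw [key, stringVec_apply, linForm_symmDiff, hM, linForm_nsfStep hab,
    edgeForm_xMeasureGraph hab]
  set D := if s = 0 then linForm (nbrs H a) x + bit (x b) else linForm (nbrs H b) x + bit (x a)
  have hexp : ∀ {y c : ℂ} {e f g e' h : ZMod 2}, e + f + g = e' + h →
      sgn e * (y * c * sgn f * (1 / 2) * (2 * sgn g)) = sgn e' * y * (c * sgn h) := by
    intro y c e f g e' h h1
    have h2 : sgn e * sgn f * sgn g = sgn e' * sgn h := by rw [← sgn_add, ← sgn_add, h1, sgn_add]
    linear_combination (y * c) * h2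
  refine hexp ?_
  have e2 : (2 : ZMod 2) = 0 := rfl
  linear_combination (D + B' * bit (x b)) * e2

end Step

/-! ### Additivity of the string update and isolation of measured qubits -/

section Nsf

variable {W : Type*} {H : SimpleGraph W} {a b : W}

lemma not_xMeasureGraph_adj_of_isolated {u : W} (hu : ∀ v, ¬ H.Adj u v) (v : W) :
    ¬ (xMeasureGraph H a b).Adj u v := by
  have hloc : ∀ {K : SimpleGraph W} (c : W), (∀ v, ¬ K.Adj u v) →
      ∀ v, ¬ (localComp K c).Adj u v := by
    intro K c hK v h
    have hcu : ¬ K.Adj c u := fun h' => hK c h'.symm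
    simp [localComp_adj, hK v, hcu] at h
  refine hloc b (fun w hw => ?_) v
  exact hloc a (hloc b hu) w (SimpleGraph.deleteIncidenceSet_le _ _ hw)

variable [Fintype W] [DecidableEq W]

lemma mem_nsfStep {S : Finset W} {v : W} :
    v ∈ nsfStep H a b S ↔ Xor (v ∈ S ∧ v ≠ a ∧ v ≠ b)
      (Xor (a ∈ S ∧ (v = b ∨ H.Adj b v ∧ v ≠ a)) (b ∈ S ∧ (xMeasureGraph H a b).Adj b v)) := by
  by_cases ha : a ∈ S <;> by_cases hb : b ∈ S <;>
    simp [nsfStep, mem_symmDiff, ha, hb, xor_def]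

lemma nsfStep_symmDiff (S T : Finset W) :
    nsfStep H a b (symmDiff S T) = symmDiff (nsfStep H a b S) (nsfStep H a b T) := by
  have hite : ∀ (v : W) (U : Finset W), (if v ∈ symmDiff S T then U else ∅) =
      symmDiff (if v ∈ S then U else ∅) (if v ∈ T then U else ∅) := by
    intro v U
    have h1 : symmDiff U ∅ = U := symmDiff_bot U
    have h2 : symmDiff ∅ U = U := bot_symmDiff U
    by_cases hS : v ∈ S <;> by_cases hT : v ∈ T <;> simp [mem_symmDiff, hS, hT, h1, h2]
  have hsdiff : symmDiff S T \ {a, b} = symmDiff (S \ {a, b}) (T \ {a, b}) := by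
    ext v
    by_cases hv : v ∈ ({a, b} : Finset W) <;> simp only [mem_symmDiff, mem_sdiff, hv] <;> tauto
  rw [nsfStep, nsfStep, nsfStep, hite, hite, hsdiff,
    symmDiff_symmDiff_symmDiff_comm (if a ∈ S then insert b (nbrs H b \ {a}) else ∅),
    symmDiff_symmDiff_symmDiff_comm (S \ {a, b})]

lemma nsfStep_of_notMem {S : Finset W} (ha : a ∉ S) (hb : b ∉ S) : nsfStep H a b S = S := by
  ext v
  simp only [mem_nsfStep, xor_def, ha, hb]
  have h1 : v = a → v ∉ S := fun h => h ▸ ha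
  have h2 : v = b → v ∉ S := fun h => h ▸ hb
  tauto

end Nsf

/-! ### The measurement sequence -/

section Sequence

variable {n : ℕ} {C : Type*} {G : SimpleGraph (Fin n ⊕ C)} {b : Fin n → C}

lemma rollGraph_succ (t : Fin n) :
    rollGraph G b (t + 1) = xMeasureGraph (rollGraph G b t) (Sum.inl t) (Sum.inr (b t)) := by
  simp [rollGraph]

lemma adj_of_isSupportSequence [Fintype C] (hb : IsSupportSequence G b) (t : Fin n) :
    (rollGraph G b t).Adj (Sum.inl t) (Sum.inr (b t)) := by
  have := hb t
  simpa [currentNbrs, peerNbrs] using this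

/-- An orchestration qubit is isolated once it has been measured. -/
lemma not_rollGraph_adj_of_lt (i : Fin n) (t : ℕ) (ht : t ≤ n) (hit : (i : ℕ) < t)
    (v : Fin n ⊕ C) : ¬ (rollGraph G b t).Adj (Sum.inl i) v := by
  induction t generalizing v with
  | zero => omega
  | succ t ih =>
    rw [rollGraph_succ ⟨t, ht⟩]
    rcases Nat.lt_succ_iff_lt_or_eq.1 hit with h | h
    · exact not_xMeasureGraph_adj_of_isolated (ih (by omega) h) v
    · have : i = ⟨t, ht⟩ := Fin.ext h
      rw [this]
      exact not_xMeasureGraph_adj_left v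

variable [DecidableEq C]

/-- The measured qubits with outcome `-` among the first `t` orchestration qubits. -/
def minusOutcomes (C : Type*) [DecidableEq C] (s : Fin n → Fin 2) (t : ℕ) : Finset (Fin n ⊕ C) :=
  (univ.filter fun i : Fin n => (i : ℕ) < t ∧ s i = 1).map Function.Embedding.inl

lemma minusOutcomes_succ (s : Fin n → Fin 2) (t : Fin n) :
    minusOutcomes C s (t + 1) =
      symmDiff (minusOutcomes C s t) (if s t = 1 then {Sum.inl t} else ∅) := by
  ext v
  rcases v with i | c
  · by_cases hi : i = t
    · subst hi; by_cases h : s i = 1 <;> simp [minusOutcomes, mem_symmDiff, h]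
    · by_cases h : s t = 1 <;> simp only [minusOutcomes, mem_symmDiff, h] <;> simp [hi] <;>
        exact fun _ => ⟨fun h => lt_of_le_of_ne h hi, le_of_lt⟩
  · by_cases h : s t = 1 <;> simp [minusOutcomes, mem_symmDiff, h]

variable [Fintype C]

/-- A `Z` string updated through the measurements of the first `t` orchestration qubits. -/
def nsfIter (G : SimpleGraph (Fin n ⊕ C)) (b : Fin n → C) (S : Finset (Fin n ⊕ C)) :
    ℕ → Finset (Fin n ⊕ C)
  | 0 => S
  | t + 1 =>
    if h : t < n then
      nsfStep (rollGraph G b t) (Sum.inl ⟨t, h⟩) (Sum.inr (b ⟨t, h⟩)) (nsfIter G b S t)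
    else nsfIter G b S t

lemma nsfIter_succ (S : Finset (Fin n ⊕ C)) (t : Fin n) :
    nsfIter G b S (t + 1) =
      nsfStep (rollGraph G b t) (Sum.inl t) (Sum.inr (b t)) (nsfIter G b S t) := by
  simp [nsfIter]

lemma nsfIter_symmDiff (S T : Finset (Fin n ⊕ C)) (t : ℕ) :
    nsfIter G b (symmDiff S T) t = symmDiff (nsfIter G b S t) (nsfIter G b T t) := by
  induction t with
  | zero => rfl
  | succ t ih =>
    simp only [nsfIter]
    split_ifs
    · rw [ih, nsfStep_symmDiff]
    · exact ih

lemma nsfString_eq_nsfIter (v : Fin n ⊕ C) (α β : Bool) (t : ℕ) :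
    nsfString G b v α β t =
      nsfIter G b (symmDiff (if α then {v} else ∅) (if β then nbrs G v else ∅)) t := by
  induction t with
  | zero => rfl
  | succ t ih => simp only [nsfString, nsfIter, ih]

/-- An updated string does not act on the measured qubits. -/
lemma inl_notMem_nsfIter (S : Finset (Fin n ⊕ C)) (i : Fin n) (t : ℕ) (ht : t ≤ n)
    (hit : (i : ℕ) < t) : Sum.inl i ∉ nsfIter G b S t := by
  induction t with
  | zero => omega
  | succ t ih =>
    have h1 : ¬ (rollGraph G b (t + 1)).Adj (Sum.inr (b ⟨t, ht⟩)) (Sum.inl i) := fun h =>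
      not_rollGraph_adj_of_lt i _ ht hit _ h.symm
    rw [rollGraph_succ ⟨t, ht⟩] at h1
    rw [nsfIter_succ S ⟨t, ht⟩, mem_nsfStep]
    rcases Nat.lt_succ_iff_lt_or_eq.1 hit with h | h
    · have h2 : ¬ (rollGraph G b t).Adj (Sum.inr (b ⟨t, ht⟩)) (Sum.inl i) := fun h' =>
        not_rollGraph_adj_of_lt i _ (by omega) h _ h'.symm
      simp [h1, h2, ih (by omega) h]
    · have : i = ⟨t, ht⟩ := Fin.ext h
      subst this
      simp [h1]

lemma seqOp_mulVec_stringVec (hb : IsSupportSequence G b) (s : Fin n → Fin 2)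
    (S : Finset (Fin n ⊕ C)) (t : ℕ) (ht : t ≤ n) :
    ∃ e : ZMod 2, seqOp G b s t *ᵥ stringVec G S =
      (sgn e * ((Real.sqrt 2 : ℂ)⁻¹) ^ t) •
        stringVec (rollGraph G b t) (symmDiff (nsfIter G b S t) (minusOutcomes C s t)) := by
  induction t with
  | zero =>
    have h0 : symmDiff S ∅ = S := symmDiff_bot S
    exact ⟨0, by simp [seqOp, rollGraph, nsfIter, minusOutcomes, h0]⟩
  | succ t ih =>
    obtain ⟨e, he⟩ := ih (by omega)
    let i : Fin n := ⟨t, ht⟩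
    have hi1 : Sum.inl i ∉ minusOutcomes C s t := by simp [minusOutcomes, i]
    have hi2 : Sum.inr (b i) ∉ minusOutcomes C s t := by simp [minusOutcomes]
    obtain ⟨e', he'⟩ := xMeasureOp_mulVec_stringVec (adj_of_isSupportSequence hb i) (s i)
      (symmDiff (nsfIter G b S t) (minusOutcomes C s t))
    refine ⟨e + e', ?_⟩
    have hs : seqOp G b s (t + 1) =
        xMeasureOp (rollGraph G b t) (Sum.inl i) (Sum.inr (b i)) (s i) * seqOp G b s t := by
      simp [seqOp, i, show t < n from ht]
    rw [hs, ← mulVec_mulVec, he, mulVec_smul, he', smul_smul, nsfStep_symmDiff,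
      nsfStep_of_notMem hi1 hi2, ← rollGraph_succ i, symmDiff_assoc, ← minusOutcomes_succ s i,
      ← nsfIter_succ S i, sgn_add, pow_succ]
    congr 1
    ring

omit [DecidableEq C] in
/-- Isolated orchestration qubits do not contribute to the edge form. -/
lemma edgeForm_elim {H : SimpleGraph (Fin n ⊕ C)} (hH : ∀ i v, ¬ H.Adj (Sum.inl i) v)
    (z : Reg (Fin n)) (y : Reg C) :
    edgeForm H (Sum.elim z y) = edgeForm (H.comap Sum.inr) y := by
  classical
  let _ : LinearOrder C := LinearOrder.lift' (Fintype.equivFin C) (Fintype.equivFin C).injective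
  let o : LinearOrder (Fin n ⊕ C) := LinearOrder.lift' (toLex : Fin n ⊕ C → Fin n ⊕ₗ C)
    toLex.injective
  have hlt : ∀ u v : C, o.lt (Sum.inr u) (Sum.inr v) ↔ u < v := fun u v =>
    Sum.Lex.inr_lt_inr_iff
  have h1 : ∀ i v, adjBit H (Sum.inl i) v = 0 := fun i v => by simp [adjBit_eq, hH]
  have h2 : ∀ i v, adjBit H v (Sum.inl i) = 0 := fun i v => by rw [adjBit_comm, h1]
  rw [edgeForm_eq_sum_lt, edgeForm_eq_sum_lt]
  have h3 : ∀ u v, adjBit (H.comap Sum.inr) u v = adjBit H (Sum.inr u) (Sum.inr v) := fun u v => by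
    simp [adjBit_eq]
  simp only [Fintype.sum_sum_type, h1, h2, h3, zero_mul, ite_self, sum_const_zero, zero_add,
    Sum.elim_inr]
  refine sum_congr rfl fun u _ => sum_congr rfl fun v _ => ?_
  exact if_congr (hlt u v) rfl rfl

/-- Discarding the measured qubits, each in the eigenstate of its outcome. -/
lemma discardOp_mulVec_stringVec {H : SimpleGraph (Fin n ⊕ C)}
    (hH : ∀ i v, ¬ H.Adj (Sum.inl i) v) (s : Fin n → Fin 2) {S : Finset (Fin n ⊕ C)}
    (hS : ∀ i, Sum.inl i ∉ S) :
    discardOp s *ᵥ stringVec H (symmDiff S (minusOutcomes C s n)) =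
      stringVec (H.comap Sum.inr) S.toRight := by
  funext y
  set r : ℂ := (Real.sqrt 2 : ℂ)⁻¹ with hr
  have hr2 : r * r * 2 = 1 := by
    have h : (Real.sqrt 2 : ℂ) * (Real.sqrt 2 : ℂ) = 2 := by
      rw [← Complex.ofReal_mul, Real.mul_self_sqrt (by norm_num)]; norm_num
    have h0 : (Real.sqrt 2 : ℂ) ≠ 0 := by
      intro h0; rw [h0] at h; norm_num at h
    rw [hr, ← h]; field_simp
  have hlin : ∀ z : Reg (Fin n), linForm (symmDiff S (minusOutcomes C s n)) (Sum.elim z y) =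
      linForm S.toRight y + ∑ i, bit (s i) * bit (z i) := by
    intro z
    rw [linForm_symmDiff, linForm_eq_sum_ite S, linForm_eq_sum_ite S.toRight,
      linForm_eq_sum_ite (minusOutcomes C s n), Fintype.sum_sum_type, Fintype.sum_sum_type]
    simp [hS, minusOutcomes, bit_eq_ite (s _)]
  have hval : ∀ z : Reg (Fin n),
      discardOp s y (Sum.elim z y) * stringVec H (symmDiff S (minusOutcomes C s n)) (Sum.elim z y) =
      r ^ n * r ^ n * stringVec (H.comap Sum.inr) S.toRight y := by
    intro z
    have h1 : discardOp s y (Sum.elim z y) = r ^ n * sgn (∑ i, bit (s i) * bit (z i)) := by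
      have h2 : ∀ i, (-1 : ℂ) ^ ((s i : ℕ) * (z i : ℕ)) = sgn (bit (s i) * bit (z i)) := by
        intro i
        rw [← sgn_natCast, Nat.cast_mul]; rfl
      simp [discardOp, prod_mul_distrib, h2, sgn_sum, hr]
    rw [h1, stringVec_apply, stringVec_apply, hlin, edgeForm_elim hH, add_right_comm,
      sgn_add _ (∑ i, _), Fintype.card_sum, Fintype.card_fin, pow_add]
    linear_combination (r ^ n * r ^ n * r ^ Fintype.card C *
      sgn (linForm S.toRight y + edgeForm (H.comap Sum.inr) y)) *
      sgn_mul_self (∑ i, bit (s i) * bit (z i))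
  rw [mulVec, dotProduct, ← Fintype.sum_of_injective (fun z : Reg (Fin n) => Sum.elim z y) ?_
    (fun _ => r ^ n * r ^ n * stringVec (H.comap Sum.inr) S.toRight y) _ ?_ fun z => (hval z).symm]
  · rw [sum_const, card_univ, Fintype.card_fun, Fintype.card_fin, Fintype.card_fin, nsmul_eq_mul]
    push_cast
    rw [← mul_assoc, mul_comm (2 ^ n : ℂ), ← mul_pow, ← mul_pow, hr2, one_pow, one_mul]
  · intro z z' h
    funext i
    exact congrFun h (Sum.inl i)
  · intro x hx
    rw [discardOp, of_apply, if_neg, zero_mul]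
    intro h
    refine hx ⟨fun i => x (Sum.inl i), ?_⟩
    funext v
    rcases v with i | c
    · rfl
    · exact (h c).symm

/-- The product in `rollOp` is elaborated as one of `CStarMatrix`, which unfolds to the matrix
product. -/
lemma rollOp_mulVec (s : Fin n → Fin 2) (ψ : Reg (Fin n ⊕ C) → ℂ) :
    rollOp G b s *ᵥ ψ = discardOp s *ᵥ (seqOp G b s n *ᵥ ψ) :=
  (mulVec_mulVec ψ (discardOp s) (seqOp G b s n)).symm

/-- The whole measurement sequence on a graph state that carries a `Z` string. -/
lemma rollOp_mulVec_stringVec (hb : IsSupportSequence G b) (s : Fin n → Fin 2)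
    (S : Finset (Fin n ⊕ C)) :
    ∃ e : ZMod 2, rollOp G b s *ᵥ stringVec G S =
      (sgn e * ((Real.sqrt 2 : ℂ)⁻¹) ^ n) •
        stringVec (finalGraph G b) (nsfIter G b S n).toRight := by
  obtain ⟨e, he⟩ := seqOp_mulVec_stringVec hb s S n le_rfl
  refine ⟨e, ?_⟩
  rw [rollOp_mulVec, he, mulVec_smul, discardOp_mulVec_stringVec]
  · rfl
  · exact fun i v => not_rollGraph_adj_of_lt i n le_rfl i.2 v
  · exact fun i => inl_notMem_nsfIter S i n le_rfl i.2

end Sequence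

/-! ### Depolarizing noise on graph states with `Z` strings -/

section Noise

variable {W : Type*} [Fintype W] [DecidableEq W]

/-- The graph state conjugated by the `Z` string on `S`. -/
def stringState (H : SimpleGraph W) (S : Finset W) : Op W :=
  vecMulVec (stringVec H S) (star (stringVec H S))

lemma stringState_empty (H : SimpleGraph W) : stringState H ∅ = graphState H := by
  simp [stringState, stringVec, graphState]

lemma mul_vecMulVec_star_mul {V U : Type*} [Fintype V] [Fintype U] (M : Matrix U V ℂ) (ψ : V → ℂ) :
    M * vecMulVec ψ (star ψ) * Mᴴ = vecMulVec (M *ᵥ ψ) (star (M *ᵥ ψ)) := by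
  rw [mul_vecMulVec, vecMulVec_mul, star_mulVec]

lemma vecMulVec_smul_star {U : Type*} (c : ℂ) (ψ : U → ℂ) :
    vecMulVec (c • ψ) (star (c • ψ)) = (c * star c) • vecMulVec ψ (star ψ) := by
  rw [star_smul, smul_vecMulVec, vecMulVec_smul, smul_smul]

lemma zOp_mul_stringState (H : SimpleGraph W) (S T : Finset W) :
    zOp T * stringState H S * zOp T = stringState H (symmDiff T S) := by
  have h := mul_vecMulVec_star_mul (zOp T) (stringVec H S)
  rwa [conjTranspose_zOp, zOp_mulVec_stringVec] at h

/-- Any vector that agrees with a string vector up to a phase gives the same state. -/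
lemma localOp_mul_stringState {H : SimpleGraph W} {S T : Finset W} {v : W}
    {A : Matrix (Fin 2) (Fin 2) ℂ} (hA : Aᴴ = A) {c : ℂ} (hc : c * star c = 1)
    (h : localOp v A *ᵥ stringVec H S = c • stringVec H T) :
    localOp v A * stringState H S * localOp v A = stringState H T := by
  have h' := mul_vecMulVec_star_mul (localOp v A) (stringVec H S)
  rwa [conjTranspose_localOp, hA, h, vecMulVec_smul_star, hc, one_smul] at h'

lemma bit_add_one : ∀ z : Fin 2, bit (z + 1) = bit z + 1 := by decide

/-- Flipping qubit `v` of a graph state acts as the `Z` string on its neighbours. -/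
lemma stringVec_flip (H : SimpleGraph W) (S : Finset W) (v : W) (x : Reg W) :
    stringVec H S (Function.update x v (x v + 1)) =
      sgn (if v ∈ S then 1 else 0) * stringVec H (symmDiff (nbrs H v) S) x := by
  have hb : bit (x v + 1) + bit (x v) = 1 := by
    rw [bit_add_one, add_right_comm, CharTwo.add_self_eq_zero, zero_add]
  rw [stringVec_apply, stringVec_apply, linForm_update, edgeForm_update, hb, mul_left_comm,
    ← sgn_add, linForm_symmDiff]
  congr 2
  ring

lemma pauliX_mul_stringState (H : SimpleGraph W) (S : Finset W) (v : W) :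
    localOp v pauliX * stringState H S * localOp v pauliX =
      stringState H (symmDiff (nbrs H v) S) := by
  refine localOp_mul_stringState (c := sgn (if v ∈ S then 1 else 0)) ?_ ?_ ?_
  · ext i j; fin_cases i <;> fin_cases j <;> simp [pauliX]
  · rw [star_sgn, sgn_mul_self]
  · funext x
    rw [localOp_mulVec, Pi.smul_apply, smul_eq_mul, ← stringVec_flip]
    have hx : ∀ z : Fin 2, z = 0 ∨ z = 1 := by decide
    rcases hx (x v) with h | h <;> simp [h, pauliX]

lemma pauliZ_mul_stringState (H : SimpleGraph W) (S : Finset W) (v : W) :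
    localOp v pauliZ * stringState H S * localOp v pauliZ = stringState H (symmDiff {v} S) := by
  refine localOp_mul_stringState (c := 1) ?_ (by simp) ?_
  · ext i j; fin_cases i <;> fin_cases j <;> simp [pauliZ]
  · funext x
    have hx : ∀ z : Fin 2, z = 0 ∨ z = 1 := by decide
    rw [localOp_mulVec, Pi.smul_apply, one_smul, ← zOp_mulVec_stringVec, zOp_eq, mulVec_diagonal,
      linForm_singleton]
    have hu := Function.update_eq_self v x
    rcases hx (x v) with h | h <;> rw [h] at hu <;> simp [h, hu, pauliZ]

lemma pauliY_mul_stringState (H : SimpleGraph W) (S : Finset W) (v : W) :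
    localOp v pauliY * stringState H S * localOp v pauliY =
      stringState H (symmDiff (symmDiff {v} (nbrs H v)) S) := by
  refine localOp_mul_stringState (c := -Complex.I * sgn (if v ∈ S then 1 else 0)) ?_ ?_ ?_
  · ext i j; fin_cases i <;> fin_cases j <;> simp [pauliY]
  · rw [star_mul', star_sgn, mul_mul_mul_comm, sgn_mul_self]
    simp
  · funext x
    have hx : ∀ z : Fin 2, z = 0 ∨ z = 1 := by decide
    rw [localOp_mulVec, Pi.smul_apply, smul_eq_mul, symmDiff_assoc, ← zOp_mulVec_stringVec H _ {v},
      zOp_eq, mulVec_diagonal, linForm_singleton, mul_assoc, mul_left_comm (sgn _),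
      ← stringVec_flip]
    rcases hx (x v) with h | h <;> simp [h, pauliY]

/-- The set of the initial noise operator `Z_v^α ∏_{k ∈ N_v} Z_k^β`. -/
def noiseSet (H : SimpleGraph W) (v : W) (α β : Bool) : Finset W :=
  symmDiff (if α then {v} else ∅) (if β then nbrs H v else ∅)

/-- On graph states with `Z` strings the depolarizing channel is a mixture of `Z` strings. -/
lemma depol_stringState (H : SimpleGraph W) (S : Finset W) (v : W) (p : ℝ) :
    depol v p (stringState H S) = (p : ℂ) • stringState H S + ((1 - p : ℂ) / 4) •
      ∑ α : Bool, ∑ β : Bool, stringState H (symmDiff (noiseSet H v α β) S) := by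
  have h1 : ∀ T : Finset W, symmDiff T ∅ = T := fun T => symmDiff_bot T
  have h2 : ∀ T : Finset W, symmDiff ∅ T = T := fun T => bot_symmDiff T
  rw [depol, pauliX_mul_stringState, pauliY_mul_stringState, pauliZ_mul_stringState]
  simp only [Fintype.sum_bool, noiseSet, if_true, Bool.false_eq_true, if_false, h1, h2]
  congr 2
  abel

lemma depol_add (v : W) (p : ℝ) (ρ σ : Op W) : depol v p (ρ + σ) = depol v p ρ + depol v p σ := by
  simp only [depol, mul_add, add_mul, smul_add]
  abel

lemma depol_smul (v : W) (p : ℝ) (c : ℂ) (ρ : Op W) : depol v p (c • ρ) = c • depol v p ρ := by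
  simp only [depol, mul_smul_comm, smul_mul_assoc, smul_add, smul_comm c]

/-- The depolarizing channel as a linear map. -/
def depolLin (v : W) (p : ℝ) : Op W →ₗ[ℂ] Op W where
  toFun := depol v p
  map_add' := depol_add v p
  map_smul' := depol_smul v p

end Noise

section Update

lemma toRight_symmDiff {U V : Type*} [DecidableEq U] [DecidableEq V] (S T : Finset (U ⊕ V)) :
    (symmDiff S T).toRight = symmDiff S.toRight T.toRight := by
  ext c
  simp [mem_symmDiff]

variable {n : ℕ} {C : Type*} [Fintype C] [DecidableEq C] {G : SimpleGraph (Fin n ⊕ C)}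
  {b : Fin n → C}

lemma updatedMap_add (v : Fin n ⊕ C) (p : ℝ) (ρ σ : Op C) :
    updatedMap G b v p (ρ + σ) = updatedMap G b v p ρ + updatedMap G b v p σ := by
  simp only [updatedMap, mul_add, add_mul, smul_add, sum_add_distrib]
  abel

lemma updatedMap_smul (v : Fin n ⊕ C) (p : ℝ) (c : ℂ) (ρ : Op C) :
    updatedMap G b v p (c • ρ) = c • updatedMap G b v p ρ := by
  simp only [updatedMap, mul_smul_comm, smul_mul_assoc, smul_add, smul_comm c, ← smul_sum]

/-- The updated map as a linear map. -/
def updatedLin (G : SimpleGraph (Fin n ⊕ C)) (b : Fin n → C) (v : Fin n ⊕ C) (p : ℝ) :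
    Op C →ₗ[ℂ] Op C where
  toFun := updatedMap G b v p
  map_add' := updatedMap_add v p
  map_smul' := updatedMap_smul v p

/-- The measurement sequence, as a linear map on operators. -/
def rollMap (G : SimpleGraph (Fin n ⊕ C)) (b : Fin n → C) (s : Fin n → Fin 2) :
    Op (Fin n ⊕ C) →ₗ[ℂ] Op C where
  toFun ρ := rollOp G b s * ρ * (rollOp G b s)ᴴ
  map_add' ρ σ := by
    exact (congrArg (fun M => M * (rollOp G b s)ᴴ) (Matrix.mul_add _ ρ σ)).trans
      (Matrix.add_mul _ _ _)
  map_smul' c ρ := by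
    exact (congrArg (fun M => M * (rollOp G b s)ᴴ) (Matrix.mul_smul (rollOp G b s) c ρ)).trans
      (Matrix.smul_mul c (rollOp G b s * ρ) _)

lemma rollMap_stringState (hb : IsSupportSequence G b) (s : Fin n → Fin 2)
    (S : Finset (Fin n ⊕ C)) :
    rollMap G b s (stringState G S) =
      (1 / 2 : ℂ) ^ n • stringState (finalGraph G b) (nsfIter G b S n).toRight := by
  obtain ⟨e, he⟩ := rollOp_mulVec_stringVec hb s S
  refine (mul_vecMulVec_star_mul (rollOp G b s) (stringVec G S)).trans ?_
  rw [he, vecMulVec_smul_star, stringState]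
  congr 1
  have h : (Real.sqrt 2 : ℂ)⁻¹ * (Real.sqrt 2 : ℂ)⁻¹ = 1 / 2 := by
    rw [← mul_inv, ← Complex.ofReal_mul, Real.mul_self_sqrt (by norm_num)]; norm_num
  rw [star_mul', star_sgn, mul_mul_mul_comm, sgn_mul_self, one_mul, ← h, mul_pow]
  congr 1
  simp

/-- The updated map is the image of the depolarizing channel under the measurement sequence. -/
lemma rollMap_depol_stringState (hb : IsSupportSequence G b) (s : Fin n → Fin 2) (v : Fin n ⊕ C)
    (p : ℝ) (S : Finset (Fin n ⊕ C)) :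
    rollMap G b s (depol v p (stringState G S)) =
      updatedMap G b v p (rollMap G b s (stringState G S)) := by
  rw [depol_stringState, rollMap_stringState hb, updatedMap_smul, updatedMap]
  simp only [map_add, map_smul, map_sum, rollMap_stringState hb, updatedNoiseOp,
    zOp_mul_stringState, nsfString_eq_nsfIter, nsfIter_symmDiff, toRight_symmDiff, noiseSet,
    smul_add, smul_sum, smul_comm ((1 / 2 : ℂ) ^ n)]

/-- Local depolarizing channels can be updated one at a time. -/
lemma rollMap_foldr_depol (hb : IsSupportSequence G b) (s : Fin n → Fin 2) (p : Fin n ⊕ C → ℝ)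
    (l : List (Fin n ⊕ C)) :
    rollMap G b s (l.foldr (fun v ρ => depol v (p v) ρ) (graphState G)) =
      l.foldr (fun v ρ => updatedMap G b v (p v) ρ) (rollMap G b s (graphState G)) := by
  have hcomm : ∀ v, Set.EqOn (rollMap G b s ∘ₗ depolLin v (p v))
      (updatedLin G b v (p v) ∘ₗ rollMap G b s)
      (Submodule.span ℂ (Set.range (stringState G)) : Submodule ℂ (Op (Fin n ⊕ C))) := by
    intro v
    refine LinearMap.eqOn_span ?_
    rintro _ ⟨S, rfl⟩
    exact rollMap_depol_stringState hb s v (p v) S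
  -- The channels keep the state inside the span of the graph states with `Z` strings.
  have hstep : ∀ v, ∀ ρ ∈ Submodule.span ℂ (Set.range (stringState G)),
      depol v (p v) ρ ∈ Submodule.span ℂ (Set.range (stringState G)) := by
    intro v
    refine (Submodule.span_le (p := (Submodule.span ℂ _).comap (depolLin v (p v)))).2 ?_
    rintro _ ⟨S, rfl⟩
    change depol v (p v) (stringState G S) ∈ Submodule.span ℂ _
    rw [depol_stringState]
    exact Submodule.add_mem _ (Submodule.smul_mem _ _ (Submodule.subset_span ⟨S, rfl⟩))
      (Submodule.smul_mem _ _ (Submodule.sum_mem _ fun α _ => Submodule.sum_mem _ fun β _ =>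
        Submodule.subset_span ⟨_, rfl⟩))
  have hspan : ∀ l : List (Fin n ⊕ C), l.foldr (fun v ρ => depol v (p v) ρ) (graphState G) ∈
      Submodule.span ℂ (Set.range (stringState G)) := by
    intro l
    induction l with
    | nil => exact Submodule.subset_span ⟨∅, stringState_empty G⟩
    | cons v l ih => exact hstep v _ ih
  induction l with
  | nil => rfl
  | cons v l ih =>
    rw [List.foldr_cons, List.foldr_cons, ← ih]
    exact hcomm v (hspan l)

end Update

/-! ### Noise operators under a measurement step -/

section NoiseSet

variable {W : Type*} [Fintype W] [DecidableEq W] {H : SimpleGraph W} {a b : W}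

lemma nsfStep_empty : nsfStep H a b ∅ = ∅ := nsfStep_of_notMem (notMem_empty _) (notMem_empty _)

lemma nsfStep_nbrs_of_ne (hab : H.Adj a b) {v : W} (hva : v ≠ a) (hvb : v ≠ b) :
    nsfStep H a b (nbrs H v) = nbrs (xMeasureGraph H a b) v := by
  have hne := hab.ne
  have ha : ∀ v, ¬ (xMeasureGraph H a b).Adj v a := fun v h => not_xMeasureGraph_adj_left v h.symm
  ext u
  rw [mem_nsfStep, mem_nbrs, mem_nbrs, mem_nbrs, mem_nbrs]
  by_cases hua : u = a
  · subst hua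
    simp [ha, hne]
  by_cases hub : u = b
  · subst hub
    simp [hvb, xor_def, SimpleGraph.adj_comm H v a,
      SimpleGraph.adj_comm (xMeasureGraph H a u) v, xMeasureGraph_adj_support hab]
  by_cases huv : u = v
  · subst huv
    simp [hua, hub, xMeasureGraph_adj_support hab, xor_def, SimpleGraph.adj_comm H u]
    tauto
  rw [xMeasureGraph_adj_of_ne hab hva hvb hua hub (Ne.symm huv), xMeasureGraph_adj_support hab]
  simp [hua, hub, SimpleGraph.adj_comm H v a, SimpleGraph.adj_comm H v b]

lemma nsfStep_nbrs_support (hab : H.Adj a b) : nsfStep H a b (nbrs H b) = {b} := by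
  ext u
  have hne := hab.ne
  by_cases hub : u = b
  · subst hub; simp [mem_nsfStep, hab.symm]
  · by_cases hua : u = a <;> simp [mem_nsfStep, hab.symm, hua, hub, hne, xor_def]

lemma nsfStep_nbrs_measured (hab : H.Adj a b) : nsfStep H a b (nbrs H a) = ∅ := by
  ext u
  by_cases hub : u = b
  · subst hub; simp [mem_nsfStep]
  · by_cases hua : u = a
    · subst hua; simp [mem_nsfStep, xMeasureGraph_adj_support hab]
    · simp [mem_nsfStep, hab, hua, hub, xMeasureGraph_adj_support hab]

lemma nsfStep_noiseSet (v : W) (α β : Bool) : nsfStep H a b (noiseSet H v α β) =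
    symmDiff (if α then nsfStep H a b {v} else ∅) (if β then nsfStep H a b (nbrs H v) else ∅) := by
  rw [noiseSet, nsfStep_symmDiff]
  cases α <;> cases β <;> simp [nsfStep_empty]

lemma nsfStep_noiseSet_of_ne (hab : H.Adj a b) {v : W} (hva : v ≠ a) (hvb : v ≠ b) (α β : Bool) :
    nsfStep H a b (noiseSet H v α β) = noiseSet (xMeasureGraph H a b) v α β := by
  rw [nsfStep_noiseSet, nsfStep_nbrs_of_ne hab hva hvb, nsfStep_of_notMem, noiseSet]
  · simpa using Ne.symm hva
  · simpa using Ne.symm hvb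

/-- The two exponents of the support vertex are exchanged. -/
lemma nsfStep_noiseSet_support (hab : H.Adj a b) (α β : Bool) :
    nsfStep H a b (noiseSet H b α β) = noiseSet (xMeasureGraph H a b) b β α := by
  have h : nsfStep H a b {b} = nbrs (xMeasureGraph H a b) b := by
    ext u
    by_cases hub : u = b <;> simp [mem_nsfStep, hab.ne, hub]
  rw [nsfStep_noiseSet, nsfStep_nbrs_support hab, h, noiseSet, symmDiff_comm]

lemma nsfStep_singleton_measured (hab : H.Adj a b) :
    nsfStep H a b {a} = insert b (nbrs H b \ {a}) := by
  ext u
  by_cases hua : u = a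
  · subst hua; simp [mem_nsfStep, hab.ne.symm, xor_def]
  · simp [mem_nsfStep, hab.ne.symm, hua, xor_def]

lemma nsfStep_noiseSet_measured (hab : H.Adj a b) (α β : Bool) :
    nsfStep H a b (noiseSet H a α β) = if α then insert b (nbrs H b \ {a}) else ∅ := by
  have h0 : ∀ T : Finset W, symmDiff T ∅ = T := fun T => symmDiff_bot T
  rw [nsfStep_noiseSet, nsfStep_nbrs_measured hab, nsfStep_singleton_measured hab, ite_self, h0]

end NoiseSet

section Updated

variable {n : ℕ} {C : Type*} [Fintype C] [DecidableEq C] {G : SimpleGraph (Fin n ⊕ C)}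
  {b : Fin n → C}

/-- The noise operator of a peer qubit keeps the form `Z_c^α ∏_{k ∈ N_c} Z_k^β` on the current
graph, up to exchanging the exponents. -/
lemma nsfIter_noiseSet_inr (hb : IsSupportSequence G b) (c : C) (t : ℕ) (ht : t ≤ n) :
    (∀ α β, nsfIter G b (noiseSet G (Sum.inr c) α β) t =
      noiseSet (rollGraph G b t) (Sum.inr c) α β) ∨
    (∀ α β, nsfIter G b (noiseSet G (Sum.inr c) α β) t =
      noiseSet (rollGraph G b t) (Sum.inr c) β α) := by
  induction t with
  | zero => exact Or.inl fun _ _ => rfl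
  | succ t ih =>
    let i : Fin n := ⟨t, ht⟩
    have hab := adj_of_isSupportSequence hb i
    have hr := rollGraph_succ (G := G) (b := b) i
    have hs := fun S => nsfIter_succ (G := G) (b := b) S i
    simp only [i] at hr hs hab
    rw [hr]
    by_cases hc : c = b ⟨t, ht⟩
    · subst hc
      rcases ih (by omega) with h | h
      · right; intro α β
        rw [hs, h, nsfStep_noiseSet_support hab]
      · left; intro α β
        rw [hs, h, nsfStep_noiseSet_support hab]
    · have hc' : (Sum.inr c : Fin n ⊕ C) ≠ Sum.inr (b ⟨t, ht⟩) := by simpa using hc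
      rcases ih (by omega) with h | h
      · left; intro α β
        rw [hs, h, nsfStep_noiseSet_of_ne hab (by simp) hc']
      · right; intro α β
        rw [hs, h, nsfStep_noiseSet_of_ne hab (by simp) hc']

/-- An orchestration qubit that is not yet measured keeps its noise operator on the current
graph. -/
lemma nsfIter_noiseSet_inl (hb : IsSupportSequence G b) (i : Fin n) (α β : Bool) (t : ℕ)
    (ht : t ≤ i) : nsfIter G b (noiseSet G (Sum.inl i) α β) t =
      noiseSet (rollGraph G b t) (Sum.inl i) α β := by
  induction t with
  | zero => rfl
  | succ t ih =>
    have htn : t < n := by have := i.2; omega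
    have hne : (Sum.inl i : Fin n ⊕ C) ≠ Sum.inl ⟨t, htn⟩ := by
      simp only [ne_eq, Sum.inl.injEq, Fin.ext_iff]; omega
    have h := nsfStep_noiseSet_of_ne (adj_of_isSupportSequence hb ⟨t, htn⟩) hne (by simp) α β
    rw [rollGraph_succ ⟨t, htn⟩, nsfIter_succ _ ⟨t, htn⟩, ← h, ← ih (by omega)]

lemma nsfIter_noiseSet_measured (hb : IsSupportSequence G b) (i : Fin n) (α β : Bool) :
    nsfIter G b (noiseSet G (Sum.inl i) α β) (i + 1) =
      if α then insert (Sum.inr (b i)) (nbrs (rollGraph G b i) (Sum.inr (b i)) \ {Sum.inl i})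
      else ∅ := by
  rw [nsfIter_succ, nsfIter_noiseSet_inl hb i α β i le_rfl,
    nsfStep_noiseSet_measured (adj_of_isSupportSequence hb i)]

/-- A peer qubit ends with the depolarizing noise operators of its final neighbourhood. -/
lemma updatedMap_inr (hb : IsSupportSequence G b) (c : C) (p : ℝ) (ρ : Op C) :
    updatedMap G b (Sum.inr c) p ρ = peerMixture c (nbrs (finalGraph G b) c) p ρ := by
  have hright : ∀ α β, (noiseSet (rollGraph G b n) (Sum.inr c) α β).toRight =
      noiseSet (finalGraph G b) c α β := by
    intro α β
    rw [noiseSet, noiseSet, toRight_symmDiff]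
    congr 1
    · cases α <;> ext d <;> simp
    · cases β <;> ext d <;> simp [finalGraph]
  have hz : ∀ α β, zOp (noiseSet (finalGraph G b) c α β) =
      (if α then zOp {c} else 1) * (if β then zOp (nbrs (finalGraph G b) c) else 1) := by
    intro α β
    rw [noiseSet, ← zOp_mul]
    cases α <;> cases β <;> simp
  have h : ∀ α β, nsfString G b (Sum.inr c) α β n =
      nsfIter G b (noiseSet G (Sum.inr c) α β) n := fun α β => nsfString_eq_nsfIter _ _ _ _
  rw [updatedMap, peerMixture]
  congr 2
  rcases nsfIter_noiseSet_inr hb c n le_rfl with h' | h' <;>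
    simp only [updatedNoiseOp, h, h', hright, hz, Fintype.sum_bool, if_true, Bool.false_eq_true,
      if_false, one_mul, mul_one] <;> abel

/-- The noise of an orchestration qubit becomes a mixture of the identity and one `Z` string. -/
lemma updatedMap_inl (hb : IsSupportSequence G b) (i : Fin n) {c : C} {N : Finset C} (hc : c ∉ N)
    (hN : ∀ β, nsfIter G b (noiseSet G (Sum.inl i) true β) n = (insert c N).map .inr)
    (p : ℝ) (ρ : Op C) :
    updatedMap G b (Sum.inl i) p ρ = orchMixture c N p ρ := by
  have h0 : ∀ β, nsfIter G b (noiseSet G (Sum.inl i) false β) n = ∅ := by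
    intro β
    have hk : ∀ t, (i : ℕ) + 1 ≤ t → nsfIter G b (noiseSet G (Sum.inl i) false β) t = ∅ := by
      intro t ht
      induction t, ht using Nat.le_induction with
      | base => rw [nsfIter_noiseSet_measured hb]; rfl
      | succ t _ ih =>
        rw [nsfIter, ih]
        split_ifs
        · exact nsfStep_empty
        · rfl
    exact hk n i.2
  have h : ∀ α β, nsfString G b (Sum.inl i) α β n =
      nsfIter G b (noiseSet G (Sum.inl i) α β) n := fun α β => nsfString_eq_nsfIter _ _ _ _
  have hz : zOp {c} * zOp N = zOp (insert c N) := by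
    rw [zOp_mul]
    congr 1
    ext d
    by_cases hd : d = c
    · subst hd; simp [mem_symmDiff, hc]
    · simp [mem_symmDiff, hd]
  have hR : ((insert c N).map (.inr : C ↪ Fin n ⊕ C)).toRight = insert c N := by
    ext d; simp
  have hE : (∅ : Finset (Fin n ⊕ C)).toRight = ∅ := rfl
  rw [updatedMap, orchMixture, hz]
  simp only [updatedNoiseOp, h, h0, hN, hR, hE, Fintype.sum_bool, zOp_empty, one_mul, mul_one]
  module

end Updated

/-! ### Levels of the peer qubits -/

section Levels

variable {n : ℕ} {C : Type*} [Fintype C]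

/-- A numbering of the peers of a tree-like graph along the chain of orchestration qubits (counted
from `0`): `o_i` is adjacent to the peers of the levels `i` and `i + 1`, and those of level `i + 1`
form its right set. The leaves of `o_0` have level `0`. -/
structure IsLevel (G : SimpleGraph (Fin n ⊕ C)) (f : C → ℕ) : Prop where
  not_adj_orch : ∀ i j : Fin n, ¬ G.Adj (Sum.inl i) (Sum.inl j)
  not_adj_peer : ∀ c d : C, ¬ G.Adj (Sum.inr c) (Sum.inr d)
  adj_iff : ∀ i c, G.Adj (Sum.inl i) (Sum.inr c) ↔ f c = i ∨ f c = i + 1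
  le : ∀ c, f c ≤ n
  mem_rightSet : ∀ i c, c ∈ rightSet G i ↔ f c = i + 1

/-- In a tree-like graph the inner orchestration qubits have no leaves, because the bridges on their
two sides already account for their degree. -/
lemma peerRank_ne_one_of_inner {G : SimpleGraph (Fin n ⊕ C)} {κ : ℕ} (hG : IsGTL G (2 * κ) κ)
    {i : Fin n} (h0 : 0 < (i : ℕ)) (h1 : (i : ℕ) + 1 < n) {c : C}
    (hc : G.Adj (Sum.inl i) (Sum.inr c)) : peerRank G c ≠ 1 := by
  classical
  intro hrank
  let j : Fin n := ⟨i - 1, by omega⟩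
  let k : Fin n := ⟨i + 1, h1⟩
  have hj := hG.bridge_regular j i (by simp only [j]; omega)
  have hk := hG.bridge_regular i k rfl
  let B : Fin n → Fin n → Finset C := fun i j => univ.filter fun c =>
    peerRank G c = 2 ∧ G.Adj (Sum.inl i) (Sum.inr c) ∧ G.Adj (Sum.inl j) (Sum.inr c)
  have hB : ∀ i j, {c : C | peerRank G c = 2 ∧ G.Adj (Sum.inl i) (Sum.inr c) ∧
      G.Adj (Sum.inl j) (Sum.inr c)} = (B i j : Set C) := by
    intro i j; ext c; simp [B]
  rw [hB, Set.ncard_coe_finset] at hj hk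
  have hdisj : Disjoint (B j i) (B i k) := by
    rw [Finset.disjoint_left]
    intro d hd hd'
    simp only [B, mem_filter, mem_univ, true_and] at hd hd'
    have hsub : ({j, i, k} : Finset (Fin n)) ⊆
        univ.filter fun i : Fin n => G.Adj (Sum.inl i) (Sum.inr d) := by
      intro l hl
      simp only [mem_insert, mem_singleton] at hl
      rcases hl with rfl | rfl | rfl <;> simp [hd, hd']
    have hcard : ({j, i, k} : Finset (Fin n)).card = 3 := by
      rw [card_eq_three]
      refine ⟨j, i, k, ?_, ?_, ?_, rfl⟩ <;> simp only [ne_eq, Fin.ext_iff, j, k] <;> omega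
    have hle := card_le_card hsub
    have h2 := hd.1
    have : 3 ≤ peerRank G d := by
      rw [hcard] at hle
      rw [peerRank]
      convert hle
    omega
  have hcn : c ∉ B j i ∪ B i k := by
    simp [B, hrank]
  have hsub : insert c (B j i ∪ B i k) ⊆ peerNbrs G i := by
    intro d hd
    simp only [mem_insert, mem_union, B, mem_filter, mem_univ, true_and] at hd
    simp only [peerNbrs, mem_filter, mem_univ, true_and]
    rcases hd with rfl | hd | hd
    · exact hc
    · exact hd.2.2
    · exact hd.2.1
  have hle := card_le_card hsub
  rw [card_insert_of_notMem hcn, card_union_of_disjoint hdisj, hj, hk, hG.peer_degree] at hle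
  omega

lemma exists_level_of_isGTL {G : SimpleGraph (Fin n ⊕ C)} {κ : ℕ} (hG : IsGTL G (2 * κ) κ)
    (c : C) : ∃ k ≤ n, (∀ i : Fin n, G.Adj (Sum.inl i) (Sum.inr c) ↔ k = i ∨ k = i + 1) ∧
      (k = 0 → 1 < n) := by
  classical
  have hrank : peerRank G c =
      (univ.filter fun i : Fin n => G.Adj (Sum.inl i) (Sum.inr c)).card := by
    rw [peerRank]
  rcases hG.rank_mem c with h | h
  · obtain ⟨i, hi⟩ := card_eq_one.1 (hrank.symm.trans h)
    have hadj : ∀ j : Fin n, G.Adj (Sum.inl j) (Sum.inr c) ↔ j = i := by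
      intro j
      have := congrArg (j ∈ ·) hi
      simpa using this
    have hin := i.2
    by_cases hlast : (i : ℕ) + 1 = n
    · refine ⟨n, le_rfl, fun j => ?_, fun h0 => by omega⟩
      have := j.2
      rw [hadj, Fin.ext_iff]; omega
    · have h0 : (i : ℕ) = 0 := by
        by_contra h0
        exact peerRank_ne_one_of_inner hG (Nat.pos_of_ne_zero h0) (by omega) ((hadj i).2 rfl) h
      refine ⟨0, by omega, fun j => ?_, fun _ => by omega⟩
      rw [hadj, Fin.ext_iff]; omega
  · obtain ⟨⟨i, j⟩, ⟨hij, hi, hj⟩, -⟩ := hG.bridge_order c h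
    simp only at hij hi hj
    have hne : i ≠ j := by rw [ne_eq, Fin.ext_iff]; omega
    have hsub : ({i, j} : Finset (Fin n)) ⊆
        univ.filter fun i : Fin n => G.Adj (Sum.inl i) (Sum.inr c) := by
      intro l hl
      simp only [mem_insert, mem_singleton] at hl
      rcases hl with rfl | rfl <;> simp [hi, hj]
    have heq := eq_of_subset_of_card_le hsub (by rw [← hrank, h, card_pair hne])
    have := j.2
    refine ⟨j, by omega, fun l => ?_, fun h0 => by omega⟩
    have hl := congrArg (l ∈ ·) heq
    simp only [mem_insert, mem_singleton, mem_filter, mem_univ, true_and, eq_iff_iff] at hl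
    rw [← hl, Fin.ext_iff, Fin.ext_iff]; omega

lemma exists_isLevel_of_isGTL {G : SimpleGraph (Fin n ⊕ C)} {κ : ℕ} (hG : IsGTL G (2 * κ) κ) :
    ∃ f : C → ℕ, IsLevel G f := by
  choose f hle hadj h0 using exists_level_of_isGTL hG
  refine ⟨f, hG.not_adj_orch, hG.not_adj_peer, fun i c => hadj c i, hle, fun i c => ?_⟩
  have hin := i.2
  have hc := hle c
  have hc0 := h0 c
  simp only [rightSet, peerNbrs, mem_filter, mem_univ, true_and, hadj]
  constructor
  · rintro ⟨h, ⟨j, hj, h'⟩ | ⟨hi, h'⟩⟩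
    · omega
    · by_cases hi0 : (i : ℕ) = 0
      · omega
      · have := h' ⟨i - 1, by omega⟩ (by simp only; omega)
        simp only at this
        omega
  · intro h
    refine ⟨Or.inr h, ?_⟩
    by_cases hi : (i : ℕ) + 1 = n
    · exact Or.inr ⟨hi, fun j hj => by omega⟩
    · exact Or.inl ⟨⟨i + 1, by omega⟩, rfl, by simp only; omega⟩

end Levels

/-! ### Roles of the peer qubits during the rolling sequence -/

/-- What has become of a peer qubit: its orchestration qubits are not measured yet (`pending`); it
is in the current rolled set (`rolled`); it was the support vertex of step `m`; or it was a non-support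
vertex of step `m` (`rest`). -/
inductive Role (n : ℕ)
  | pending
  | rolled
  | support (m : Fin n)
  | rest (m : Fin n)

namespace Role

variable {n : ℕ}

/-- The roles of two adjacent peers in every graph of the rolling sequence. -/
def Linked : Role n → Role n → Prop
  | support _, rolled => True
  | rolled, support _ => True
  | support m, rest k => m = k
  | rest k, support m => m = k
  | _, _ => False

/-- The role of a peer other than the support vertex after step `t`. The propositions say that the
support vertex is on the right, and that the peer is in the right set of `o_t`. -/
def next (t : Fin n) (right inRight : Prop) [Decidable right] [Decidable inRight] :
    Role n → Role n
  | rolled => if right then rolled else rest t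
  | pending => if inRight then (if right then rest t else rolled) else pending
  | support m => support m
  | rest m => rest m

lemma next_eq_rolled {t : Fin n} {right x : Prop} [Decidable right] [Decidable x] {r : Role n} :
    r.next t right x = rolled ↔ (right ∧ r = rolled) ∨ (¬ right ∧ x ∧ r = pending) := by
  by_cases hR : right <;> by_cases hX : x <;> cases r <;> simp [next, hR, hX]

lemma next_eq_pending {t : Fin n} {right x : Prop} [Decidable right] [Decidable x] {r : Role n} :
    r.next t right x = pending ↔ r = pending ∧ ¬ x := by
  by_cases hR : right <;> by_cases hX : x <;> cases r <;> simp [next, hR, hX]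

lemma next_eq_support {t m : Fin n} {right x : Prop} [Decidable right] [Decidable x] {r : Role n} :
    r.next t right x = support m ↔ r = support m := by
  by_cases hR : right <;> by_cases hX : x <;> cases r <;> simp [next, hR, hX]

lemma next_eq_rest {t m : Fin n} {right x : Prop} [Decidable right] [Decidable x] {r : Role n} :
    r.next t right x = rest m ↔
      r = rest m ∨ (m = t ∧ ((¬ right ∧ r = rolled) ∨ (right ∧ x ∧ r = pending))) := by
  by_cases hR : right <;> by_cases hX : x <;> cases r <;> simp [next, hR, hX, eq_comm]

/-- The links after a step, in terms of those before it. A support vertex on the left is itself a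
rolled vertex, so that it is linked to the earlier support vertices; one on the right has no
links. -/
lemma linked_next (t : Fin n) (right : Prop) [Decidable right] {r r' : Role n} {x x' : Prop}
    [Decidable x] [Decidable x'] (hx : x → r = pending) (hx' : x' → r' = pending)
    (hs : ∀ m, r = support m → m ≠ t) (hs' : ∀ m, r' = support m → m ≠ t) :
    (r.next t right x).Linked (r'.next t right x') ↔
      Xor (r.Linked r') (Xor ((r = rolled ∨ x) ∧ (¬ right ∧ rolled.Linked r'))
        ((¬ right ∧ rolled.Linked r) ∧ (r' = rolled ∨ x'))) := by
  by_cases hR : right <;> by_cases hX : x <;> by_cases hX' : x' <;>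
    cases r <;> cases r' <;> simp_all [next, Linked, xor_def, eq_comm]

end Role

section Rolling

variable {n : ℕ} {C : Type*} [DecidableEq C]

/-- The role of a peer after the measurements of `o_0, …, o_{t-1}`, in terms of its level. -/
def role (f : C → ℕ) (b : Fin n → C) : ℕ → C → Role n
  | 0, c => if f c = 0 then .rolled else .pending
  | t + 1, c =>
    if h : t < n then
      if c = b ⟨t, h⟩ then .support ⟨t, h⟩
      else (role f b t c).next ⟨t, h⟩ (f (b ⟨t, h⟩) = t + 1) (f c = t + 1)
    else role f b t c

lemma role_succ (f : C → ℕ) (b : Fin n → C) (t : Fin n) (c : C) :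
    role f b (t + 1) c = if c = b t then .support t
      else (role f b t c).next t (f (b t) = t + 1) (f c = t + 1) := by
  simp [role]

/-- The shape of the graph after `t` measurements, in terms of the roles of the peers. -/
structure RollShape (G : SimpleGraph (Fin n ⊕ C)) (f : C → ℕ) (b : Fin n → C) (t : ℕ) : Prop where
  pending_iff : ∀ c, role f b t c = .pending ↔ t < f c
  support_iff : ∀ m c, role f b t c = .support m ↔ (m : ℕ) < t ∧ c = b m
  lt_of_rest : ∀ m c, role f b t c = .rest m → (m : ℕ) < t
  not_adj_orch : ∀ i j, ¬ (rollGraph G b t).Adj (Sum.inl i) (Sum.inl j)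
  adj_current : ∀ (i : Fin n) c, (i : ℕ) = t →
    ((rollGraph G b t).Adj (Sum.inl i) (Sum.inr c) ↔ role f b t c = .rolled ∨ f c = t + 1)
  adj_later : ∀ (i : Fin n) c, t < (i : ℕ) →
    ((rollGraph G b t).Adj (Sum.inl i) (Sum.inr c) ↔ f c = i ∨ f c = i + 1)
  adj_peer : ∀ c d, (rollGraph G b t).Adj (Sum.inr c) (Sum.inr d) ↔
    (role f b t c).Linked (role f b t d)

variable [Fintype C] {G : SimpleGraph (Fin n ⊕ C)} {f : C → ℕ} {b : Fin n → C}

lemma rollShape_zero (hf : IsLevel G f) : RollShape G f b 0 := by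
  refine ⟨fun c => ?_, fun m c => ?_, fun m c => ?_, fun i j => hf.not_adj_orch i j,
    fun i c hi => ?_, fun i c hi => hf.adj_iff i c, fun c d => ?_⟩
  · by_cases h : f c = 0 <;> simp [role, h, Nat.pos_iff_ne_zero]
  · by_cases h : f c = 0 <;> simp [role, h]
  · by_cases h : f c = 0 <;> simp [role, h]
  · have := hf.adj_iff i c
    rw [hi] at this
    by_cases h : f c = 0 <;> simp [role, rollGraph, h, this]
  · have := hf.not_adj_peer c d
    by_cases h : f c = 0 <;> by_cases h' : f d = 0 <;>
      simp [role, rollGraph, h, h', this, Role.Linked]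

lemma RollShape.support_side {t : ℕ} (h : RollShape G f b t) (hb : IsSupportSequence G b)
    (i : Fin n) (hi : (i : ℕ) = t) : role f b t (b i) = .rolled ∨ f (b i) = t + 1 :=
  (h.adj_current i _ hi).1 (hi ▸ adj_of_isSupportSequence hb i)

lemma Role.not_linked_self (r : Role n) : ¬ r.Linked r := by
  cases r <;> simp [Role.Linked]

/-- The rolling step preserves the shape. -/
lemma rollShape_succ (hb : IsSupportSequence G b) (t : Fin n) (h : RollShape G f b t) :
    RollShape G f b (t + 1) := by
  have hab := adj_of_isSupportSequence hb t
  have hA := fun c => h.adj_current t c rfl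
  have hside := h.support_side hb t rfl
  have hgb : role f b (t + 1) (b t) = .support t := by simp [role_succ]
  have hg : ∀ c, c ≠ b t → role f b (t + 1) c =
      (role f b t c).next t (f (b t) = t + 1) (f c = t + 1) := by
    intro c hc; simp [role_succ, hc]
  have hpend : ∀ c, f c = t + 1 → role f b t c = .pending := fun c hc =>
    (h.pending_iff c).2 (by omega)
  have hnsup : ∀ c m, role f b t c = .support m → m ≠ t := by
    rintro c m hm rfl
    exact lt_irrefl _ ((h.support_iff m c).1 hm).1
  -- A support vertex on the right has no peer neighbours, one on the left has those of a rolled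
  -- vertex.
  have hB : ∀ d, (rollGraph G b t).Adj (Sum.inr (b t)) (Sum.inr d) ↔
      ¬ f (b t) = t + 1 ∧ Role.rolled.Linked (role f b t d) := by
    intro d
    rw [h.adj_peer]
    rcases hside with hr | hr
    · have : ¬ f (b t) = t + 1 := fun h' => by simp [hpend _ h'] at hr
      simp [hr, this]
    · rw [hpend _ hr]
      cases role f b t d <;> simp [hr, Role.Linked]
  have hle : f (b t) ≤ t + 1 := by
    rcases hside with hr | hr
    · have := (h.pending_iff (b t)).not.1 (by simp [hr])
      omega
    · exact hr.le
  have hroll : rollGraph G b (t + 1) = _ := rollGraph_succ t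
  have hsupp : ∀ d, (rollGraph G b (t + 1)).Adj (Sum.inr (b t)) (Sum.inr d) ↔
      Role.Linked (.support t) (role f b (t + 1) d) := by
    intro d
    rw [hroll, xMeasureGraph_adj_support hab]
    by_cases hd : d = b t
    · subst hd; simp [hgb, Role.Linked]
    rw [hA, hg d hd]
    have h1 := hpend d
    have h2 := fun m => h.lt_of_rest m d
    by_cases hR : f (b t) = t + 1 <;> by_cases hX : f d = t + 1 <;>
      cases hrd : role f b t d <;> simp_all [Role.next, Role.Linked]
    all_goals exact fun h' => by subst h'; exact lt_irrefl _ h2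
  have hadj_later : ∀ i c, t < i → ((rollGraph G b (t + 1)).Adj (Sum.inl i) (Sum.inr c) ↔
      c ≠ b t ∧ Xor (f c = i ∨ f c = i + 1) (((i : ℕ) = t + 1 ∧ f (b t) = t + 1) ∧
        (role f b t c = .rolled ∨ f c = t + 1))) := by
    intro i c hi
    have hit : (t : ℕ) < i := hi
    rw [hroll]
    by_cases hc : c = b t
    · subst hc
      rw [SimpleGraph.adj_comm, xMeasureGraph_adj_support hab]
      simp [h.not_adj_orch]
    · rw [xMeasureGraph_adj_of_ne hab (by simpa using hi.ne') (by simp) (by simp) (by simpa)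
        (by simp), hA, SimpleGraph.adj_comm _ (Sum.inr (b t)) (Sum.inl i), h.adj_later i c hit,
        h.adj_later i (b t) hit]
      have : (f (b t) = i ∨ f (b t) = i + 1) ↔ ((i : ℕ) = t + 1 ∧ f (b t) = t + 1) := by omega
      simp [hc, h.not_adj_orch, this]
  refine ⟨fun c => ?_, fun m c => ?_, fun m c => ?_, fun i j => ?_, fun i c hi => ?_,
    fun i c hi => ?_, fun c d => ?_⟩
  · by_cases hc : c = b t
    · subst hc; simp [hgb]; omega
    · rw [hg c hc, Role.next_eq_pending, h.pending_iff]
      omega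
  · by_cases hc : c = b t
    · subst hc
      rw [hgb, Role.support.injEq]
      constructor
      · rintro rfl
        exact ⟨Nat.lt_succ_self _, rfl⟩
      · rintro ⟨hm, hbm⟩
        by_contra hne
        have hlt : (m : ℕ) < t := by
          have : (t : ℕ) ≠ m := fun h' => hne (Fin.ext h')
          omega
        have hm' := (h.support_iff m (b t)).2 ⟨hlt, hbm⟩
        rcases hside with hr | hr
        · simp [hm'] at hr
        · exact absurd (hpend _ hr) (by simp [hm'])
    · rw [hg c hc, Role.next_eq_support, h.support_iff]
      refine and_congr_left fun hcm => ?_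
      have : (m : ℕ) ≠ t := fun h' => hc (by rw [hcm, Fin.ext h'])
      omega
  · intro hm
    by_cases hc : c = b t
    · subst hc; simp [hgb] at hm
    · rw [hg c hc, Role.next_eq_rest] at hm
      rcases hm with hm | ⟨rfl, -⟩
      · exact (h.lt_of_rest m c hm).trans (Nat.lt_succ_self _)
      · exact Nat.lt_succ_self _
  · rw [hroll]
    by_cases hit : i = t
    · subst hit; exact not_xMeasureGraph_adj_left _
    by_cases hjt : j = t
    · subst hjt; exact fun h' => not_xMeasureGraph_adj_left _ h'.symm
    by_cases hij : i = j
    · subst hij; simp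
    rw [xMeasureGraph_adj_of_ne hab (by simpa) (by simp) (by simpa) (by simp) (by simpa)]
    simp [h.not_adj_orch]
  · have hit : i ≠ t := fun h' => by rw [h'] at hi; omega
    rw [hadj_later i c (Fin.lt_def.2 (by omega)), hi]
    by_cases hc : c = b t
    · subst hc
      simp [hgb]
      omega
    · rw [hg c hc, Role.next_eq_rolled, h.pending_iff]
      have h1 : role f b t c = .rolled → ¬ (t : ℕ) < f c := fun hr h' => by
        rw [(h.pending_iff c).2 h'] at hr; simp at hr
      simp only [ne_eq, hc, not_false_eq_true, true_and, xor_def]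
      by_cases hr : role f b t c = .rolled
      · have h2 := h1 hr
        simp only [hr, true_or, and_true]
        omega
      · simp only [hr, false_or, and_false]
        omega
  · rw [hadj_later i c (Fin.lt_def.2 (by omega))]
    have h1 : (i : ℕ) ≠ t + 1 := by omega
    by_cases hc : c = b t
    · subst hc
      simp
      omega
    · simp [hc, h1, xor_def]
  · by_cases hc : c = b t
    · subst hc; rw [hsupp, hgb]
    by_cases hd : d = b t
    · subst hd
      rw [SimpleGraph.adj_comm, hsupp, hgb]
      cases role f b (t + 1) c <;> simp [Role.Linked]
    by_cases hcd : c = d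
    · subst hcd
      simp [Role.not_linked_self]
    rw [hroll, xMeasureGraph_adj_of_ne hab (by simp) (by simpa) (by simp) (by simpa) (by simpa),
      hA, hA, hB, hB, h.adj_peer, hg c hc, hg d hd,
      Role.linked_next t _ (hpend c) (hpend d) (hnsup c) (hnsup d)]

end Rolling

/-! ### Final neighbourhoods of the peer qubits -/

section Final

variable {n : ℕ} {C : Type*} [Fintype C] [DecidableEq C] {G : SimpleGraph (Fin n ⊕ C)}
  {f : C → ℕ} {b : Fin n → C}

lemma rollShape (hf : IsLevel G f) (hb : IsSupportSequence G b) (t : ℕ) (ht : t ≤ n) :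
    RollShape G f b t := by
  induction t with
  | zero => exact rollShape_zero hf
  | succ t ih => exact rollShape_succ hb ⟨t, ht⟩ (ih (by omega))

lemma mem_currentNbrs (hf : IsLevel G f) (hb : IsSupportSequence G b) (i : Fin n) (c : C) :
    c ∈ currentNbrs G b i ↔ role f b i c = .rolled ∨ f c = i + 1 := by
  rw [← (rollShape hf hb i i.2.le).adj_current i c rfl]
  simp [currentNbrs, peerNbrs]

omit [Fintype C] in
lemma RollShape.not_level_of_rolled {t : ℕ} (h : RollShape G f b t) {c : C}
    (hc : role f b t c = .rolled) : f c ≠ t + 1 := by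
  intro h'
  rw [(h.pending_iff c).2 (by omega)] at hc
  simp at hc

lemma mem_rolledSet (hf : IsLevel G f) (hb : IsSupportSequence G b) (i : Fin n) (c : C) :
    c ∈ rolledSet G b i ↔ role f b (i + 1) c = .rolled := by
  have h := rollShape hf hb i i.2.le
  have hside := h.support_side hb i rfl
  have h1 : ∀ c, f c = i + 1 → role f b i c = .pending := fun c hc =>
    (h.pending_iff c).2 (by omega)
  have h2 := fun c => h.not_level_of_rolled (c := c)
  rw [role_succ, rolledSet]
  by_cases hc : c = b i
  · subst hc
    by_cases hR : f (b i) = i + 1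
    · simp [hf.mem_rightSet, hR]
    · simp [hf.mem_rightSet, hR]
  · rw [if_neg hc, Role.next_eq_rolled]
    by_cases hR : f (b i) = i + 1
    · simp only [hf.mem_rightSet, hR, if_true, mem_sdiff, mem_currentNbrs hf hb]
      have := h2 c
      tauto
    · simp only [hf.mem_rightSet, hR, if_false]
      have := h1 c
      tauto

lemma mem_nonSupport (hf : IsLevel G f) (hb : IsSupportSequence G b) (i : Fin n) (c : C) :
    c ∈ nonSupport G b i ↔ role f b (i + 1) c = .rest i := by
  have h := rollShape hf hb i i.2.le
  have hside := h.support_side hb i rfl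
  have h1 : ∀ c, f c = i + 1 → role f b i c = .pending := fun c hc =>
    (h.pending_iff c).2 (by omega)
  have h2 := fun c => h.not_level_of_rolled (c := c)
  rw [role_succ, nonSupport]
  by_cases hc : c = b i
  · subst hc; simp
  · have h3 : role f b i c ≠ .rest i := fun h' => lt_irrefl _ (h.lt_of_rest i c h')
    rw [if_neg hc, Role.next_eq_rest]
    by_cases hR : f (b i) = i + 1
    · simp only [hf.mem_rightSet, hR, if_true, mem_sdiff, mem_singleton, hc]
      have := h1 c
      tauto
    · simp only [hf.mem_rightSet, hR, if_false, mem_sdiff, mem_singleton, hc,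
        mem_currentNbrs hf hb]
      have := h1 c
      have := h2 c
      tauto

/-- The non-support vertices of step `m` keep their role. -/
lemma role_eq_rest_iff (hf : IsLevel G f) (hb : IsSupportSequence G b) (m : Fin n) (c : C)
    (t : ℕ) (hmt : (m : ℕ) + 1 ≤ t) (ht : t ≤ n) :
    role f b t c = .rest m ↔ role f b (m + 1) c = .rest m := by
  induction t, hmt using Nat.le_induction with
  | base => rfl
  | succ t hmt ih =>
    rw [← ih (by omega)]
    have h := rollShape hf hb t (by omega)
    have hr := role_succ f b ⟨t, ht⟩ c
    have hne : m ≠ ⟨t, ht⟩ := fun h' => by rw [h'] at hmt; simp at hmt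
    simp only at hr
    rw [hr]
    by_cases hc : c = b ⟨t, ht⟩
    · subst hc
      rw [if_pos rfl]
      have hside := h.support_side hb ⟨t, ht⟩ rfl
      constructor
      · intro h'; simp at h'
      · intro h'
        rcases hside with hs | hs
        · simp [h'] at hs
        · rw [(h.pending_iff _).2 (by omega)] at h'; simp at h'
    · rw [if_neg hc, Role.next_eq_rest]
      tauto

lemma support_injective (hf : IsLevel G f) (hb : IsSupportSequence G b) :
    Function.Injective b := by
  have h := rollShape hf hb n le_rfl
  intro i j hij
  have h1 := (h.support_iff i (b i)).2 ⟨i.2, rfl⟩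
  have h2 := (h.support_iff j (b i)).2 ⟨j.2, hij⟩
  rw [h1] at h2
  exact Role.support.inj h2

/-- The final neighbourhood of a peer, in terms of the final roles. -/
lemma mem_nbrs_finalGraph (hf : IsLevel G f) (hb : IsSupportSequence G b) (c d : C) :
    d ∈ nbrs (finalGraph G b) c ↔ (role f b n c).Linked (role f b n d) := by
  rw [mem_nbrs, ← (rollShape hf hb n le_rfl).adj_peer]
  rfl

lemma role_final_eq_support (hf : IsLevel G f) (hb : IsSupportSequence G b) (m : Fin n) (c : C) :
    role f b n c = .support m ↔ c = b m := by
  rw [(rollShape hf hb n le_rfl).support_iff]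
  simp

lemma role_final_eq_rest (hf : IsLevel G f) (hb : IsSupportSequence G b) (m : Fin n) (c : C) :
    role f b n c = .rest m ↔ c ∈ nonSupport G b m := by
  rw [role_eq_rest_iff hf hb m c n m.2 le_rfl, mem_nonSupport hf hb]

lemma role_final_eq_rolled (hf : IsLevel G f) (hb : IsSupportSequence G b) {last : Fin n}
    (hlast : (last : ℕ) + 1 = n) (c : C) :
    role f b n c = .rolled ↔ c ∈ rolledSet G b last := by
  rw [mem_rolledSet hf hb, hlast]

lemma nbrs_finalGraph_support (hf : IsLevel G f) (hb : IsSupportSequence G b) {last : Fin n}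
    (hlast : (last : ℕ) + 1 = n) (m : Fin n) :
    nbrs (finalGraph G b) (b m) = rolledSet G b last ∪ nonSupport G b m := by
  ext d
  rw [mem_nbrs_finalGraph hf hb, (role_final_eq_support hf hb m _).2 rfl, mem_union,
    ← role_final_eq_rolled hf hb hlast, ← role_final_eq_rest hf hb]
  cases role f b n d <;> simp [Role.Linked, eq_comm]

lemma nbrs_finalGraph_rolled (hf : IsLevel G f) (hb : IsSupportSequence G b) {last : Fin n}
    (hlast : (last : ℕ) + 1 = n) {c : C} (hc : c ∈ rolledSet G b last) :
    nbrs (finalGraph G b) c = univ.image b := by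
  ext d
  rw [mem_nbrs_finalGraph hf hb, (role_final_eq_rolled hf hb hlast c).2 hc]
  have h : d ∈ univ.image b ↔ ∃ m, role f b n d = .support m := by
    simp [role_final_eq_support hf hb, eq_comm]
  rw [h]
  cases role f b n d <;> simp [Role.Linked]

lemma nbrs_finalGraph_nonSupport (hf : IsLevel G f) (hb : IsSupportSequence G b) {m : Fin n}
    {c : C} (hc : c ∈ nonSupport G b m) : nbrs (finalGraph G b) c = {b m} := by
  ext d
  rw [mem_nbrs_finalGraph hf hb, (role_final_eq_rest hf hb m c).2 hc, mem_singleton,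
    ← role_final_eq_support hf hb]
  cases role f b n d <;> simp [Role.Linked]

lemma peer_classification (hf : IsLevel G f) (hb : IsSupportSequence G b) {last : Fin n}
    (hlast : (last : ℕ) + 1 = n) (c : C) :
    (∃ m, c = b m) ∨ c ∈ rolledSet G b last ∨ ∃ m, c ∈ nonSupport G b m := by
  simp only [← role_final_eq_support hf hb, ← role_final_eq_rest hf hb,
    ← role_final_eq_rolled hf hb hlast]
  have h := (rollShape hf hb n le_rfl).pending_iff c
  have hle := hf.le c
  cases hr : role f b n c
  · exact absurd (h.1 hr) (by omega)
  · simp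
  · simp
  · simp

/-! ### The noise operators of the orchestration qubits -/

lemma nbrs_support_of_right (hf : IsLevel G f) (hb : IsSupportSequence G b) {i : Fin n}
    (hi : b i ∈ rightSet G i) :
    nbrs (rollGraph G b i) (Sum.inr (b i)) \ {Sum.inl i} =
      (univ.filter fun j : Fin n => (j : ℕ) = i + 1).map .inl := by
  have h := rollShape hf hb i i.2.le
  rw [hf.mem_rightSet] at hi
  ext v
  rcases v with j | c
  · simp only [mem_sdiff, mem_nbrs, mem_singleton, Sum.inl.injEq, mem_map, mem_filter, mem_univ,
      true_and, Function.Embedding.inl_apply, exists_eq_right, SimpleGraph.adj_comm _ (Sum.inr _)]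
    rcases lt_trichotomy (j : ℕ) i with hj | hj | hj
    · simp only [not_rollGraph_adj_of_lt j i i.2.le hj, false_and, false_iff]
      omega
    · simp [Fin.ext hj]
    · rw [h.adj_later j _ hj, Fin.ext_iff]
      omega
  · have hp : role f b i (b i) = .pending := (h.pending_iff _).2 (by omega)
    simp only [mem_sdiff, mem_nbrs, h.adj_peer, hp]
    simp [Role.Linked]

lemma nbrs_support_of_left (hf : IsLevel G f) (hb : IsSupportSequence G b) {i : Fin n}
    (hi : b i ∉ rightSet G i) :
    nbrs (rollGraph G b i) (Sum.inr (b i)) \ {Sum.inl i} = ((Iio i).image b).map .inr := by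
  have h := rollShape hf hb i i.2.le
  rw [hf.mem_rightSet] at hi
  have hr : role f b i (b i) = .rolled := (h.support_side hb i rfl).resolve_right hi
  have hle : ¬ (i : ℕ) < f (b i) := fun h' => by
    rw [(h.pending_iff _).2 h'] at hr; simp at hr
  ext v
  rcases v with j | c
  · simp only [mem_sdiff, mem_nbrs, mem_singleton, Sum.inl.injEq, mem_map,
      Function.Embedding.inr_apply, SimpleGraph.adj_comm _ (Sum.inr _)]
    rcases lt_trichotomy (j : ℕ) i with hj | hj | hj
    · simp [not_rollGraph_adj_of_lt j i i.2.le hj]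
    · simp [Fin.ext hj]
    · rw [h.adj_later j _ hj, Fin.ext_iff]
      simp
      omega
  · have hl : (c ∈ (Iio i).image b) ↔ ∃ m, role f b i c = .support m := by
      simp only [h.support_iff, mem_image, mem_Iio, eq_comm, Fin.lt_def]
    simp only [mem_sdiff, mem_nbrs, h.adj_peer, hr, mem_map, Function.Embedding.inr_apply,
      Sum.inr.injEq, exists_eq_right, hl, mem_singleton, reduceCtorEq, not_false_eq_true, and_true]
    cases role f b i c <;> simp [Role.Linked]

/-- A string on support vertices of earlier steps is not changed any more. -/
lemma nsfIter_eq_of_supports (hinj : Function.Injective b) (S : Finset (Fin n ⊕ C)) {t : ℕ}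
    {M : Finset (Fin n)} (hM : ∀ l ∈ M, (l : ℕ) < t) (h : nsfIter G b S t = (M.image b).map .inr)
    (t' : ℕ) (ht : t ≤ t') : nsfIter G b S t' = (M.image b).map .inr := by
  induction t', ht using Nat.le_induction with
  | base => exact h
  | succ t' ht ih =>
    rw [nsfIter, ih]
    split_ifs with hn
    · refine nsfStep_of_notMem (by simp) ?_
      simp only [mem_map, mem_image, Function.Embedding.inr_apply, Sum.inr.injEq,
        exists_eq_right, not_exists, not_and]
      intro l hl hbl
      have := hM l hl
      rw [hinj hbl] at this
      simp only at this
      omega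
    · rfl

/-- Right supports pass the noise of `o_i` on to the next orchestration qubit, leaving a `Z` on each
support vertex. -/
lemma nsfIter_noiseSet_of_right (hf : IsLevel G f) (hb : IsSupportSequence G b) (i : Fin n)
    (β : Bool) (m : ℕ) (him : (i : ℕ) ≤ m) (hm : m < n)
    (hright : ∀ l : Fin n, i ≤ l → (l : ℕ) < m → b l ∈ rightSet G l) :
    nsfIter G b (noiseSet G (Sum.inl i) true β) (m + 1) =
      symmDiff (((Ico i ⟨m, hm⟩).image b).map .inr)
        (insert (Sum.inr (b ⟨m, hm⟩))
          (nbrs (rollGraph G b m) (Sum.inr (b ⟨m, hm⟩)) \ {Sum.inl ⟨m, hm⟩})) := by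
  have hinj := support_injective hf hb
  induction m, him using Nat.le_induction with
  | base =>
    rw [nsfIter_noiseSet_measured hb]
    simp only [Fin.eta, Ico_self, image_empty, map_empty, if_true]
    exact (bot_symmDiff _).symm
  | succ m him ih =>
    let k : Fin n := ⟨m, by omega⟩
    let t : Fin n := ⟨m + 1, hm⟩
    have hk : b k ∈ rightSet G k := hright k him (Nat.lt_succ_self _)
    have hsplit : symmDiff (((Ico i k).image b).map .inr) (insert (Sum.inr (b k))
        (nbrs (rollGraph G b m) (Sum.inr (b k)) \ {Sum.inl k})) =
        symmDiff (((Ico i t).image b).map .inr) {Sum.inl t} := by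
      rw [nbrs_support_of_right hf hb hk]
      ext v
      rcases v with j | c
      · simp only [mem_symmDiff, mem_map, mem_insert, mem_filter, mem_univ, true_and,
          Function.Embedding.inl_apply, Function.Embedding.inr_apply, Sum.inl.injEq, reduceCtorEq,
          and_false, exists_false, false_and, false_or, not_false_eq_true, and_true,
          mem_singleton, Fin.ext_iff, k, t]
        exact ⟨fun ⟨a, h1, h2⟩ => h2 ▸ h1, fun h => ⟨j, h, rfl⟩⟩
      · have h1 : ∀ l : Fin n, l ∈ Ico i t ↔ l ∈ Ico i k ∨ l = k := by
          intro l
          simp only [mem_Ico, Fin.le_def, Fin.lt_def, Fin.ext_iff, k, t]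
          omega
        have h2 : c = b k → c ∉ (Ico i k).image b := by
          rintro rfl h
          obtain ⟨l, hl, hbl⟩ := mem_image.1 h
          rw [hinj hbl] at hl
          simp at hl
        have h3 : c ∈ (Ico i t).image b ↔ c ∈ (Ico i k).image b ∨ c = b k := by
          simp only [mem_image, h1]
          constructor
          · rintro ⟨l, hl | rfl, rfl⟩
            · exact Or.inl ⟨l, hl, rfl⟩
            · exact Or.inr rfl
          · rintro (⟨l, hl, rfl⟩ | rfl)
            · exact ⟨l, Or.inl hl, rfl⟩
            · exact ⟨k, Or.inr rfl, rfl⟩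
        simp only [mem_symmDiff, mem_map, Function.Embedding.inr_apply, Sum.inr.injEq,
          exists_eq_right, mem_insert, Function.Embedding.inl_apply, reduceCtorEq, and_false,
          exists_false, or_false, mem_singleton, h3, not_false_eq_true, and_true]
        tauto
    have hfix : nsfStep (rollGraph G b t) (Sum.inl t) (Sum.inr (b t))
        (((Ico i t).image b).map .inr) = ((Ico i t).image b).map .inr := by
      refine nsfStep_of_notMem (by simp) ?_
      simp only [mem_map, mem_image, Function.Embedding.inr_apply, Sum.inr.injEq,
        exists_eq_right, not_exists, not_and]
      intro l hl hbl
      rw [hinj hbl] at hl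
      simp at hl
    rw [nsfIter_succ _ t, ih (by omega) fun l hil hl => hright l hil (by omega)]
    change nsfStep _ _ _ (symmDiff (((Ico i k).image b).map .inr) (insert (Sum.inr (b k))
        (nbrs (rollGraph G b m) (Sum.inr (b k)) \ {Sum.inl k}))) = _
    rw [hsplit, nsfStep_symmDiff, hfix,
      nsfStep_singleton_measured (adj_of_isSupportSequence hb t)]

/-- A left support at step `m` turns the string into one on support vertices only. -/
lemma nsfIter_noiseSet_of_left (hf : IsLevel G f) (hb : IsSupportSequence G b) {i m : Fin n}
    (him : i ≤ m) (hright : ∀ l, i ≤ l → l < m → b l ∈ rightSet G l) (hm : b m ∉ rightSet G m)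
    (β : Bool) : nsfIter G b (noiseSet G (Sum.inl i) true β) n =
      (insert (b m) ((Iio i).image b)).map .inr := by
  have hinj := support_injective hf hb
  rw [← image_insert]
  refine nsfIter_eq_of_supports hinj _ (t := m + 1) ?_ ?_ n m.2
  · intro l hl
    simp only [mem_insert, mem_Iio, Fin.lt_def, Fin.ext_iff] at hl
    have := Fin.le_def.1 him
    omega
  · rw [nsfIter_noiseSet_of_right hf hb i β m him m.2 fun l hil hl => hright l hil hl,
      Fin.eta, nbrs_support_of_left hf hb hm]
    ext v
    rcases v with j | c
    · simp [mem_symmDiff]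
    · simp only [mem_symmDiff, mem_map, Function.Embedding.inr_apply, Sum.inr.injEq,
        exists_eq_right, mem_insert, mem_image, mem_Ico, mem_Iio]
      constructor
      · rintro (⟨⟨l, hl, rfl⟩, h⟩ | ⟨rfl | ⟨l, hl, rfl⟩, h⟩)
        · exact absurd (Or.inr ⟨l, hl.2, rfl⟩) h
        · exact ⟨m, Or.inl rfl, rfl⟩
        · exact ⟨l, Or.inr (not_le.1 fun hil => h ⟨l, ⟨hil, hl⟩, rfl⟩), rfl⟩
      · rintro ⟨l, rfl | hl, rfl⟩
        · refine Or.inr ⟨Or.inl rfl, ?_⟩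
          rintro ⟨k, hk, hkl⟩
          exact hk.2.ne (hinj hkl)
        · refine Or.inr ⟨Or.inr ⟨l, hl.trans_le him, rfl⟩, ?_⟩
          rintro ⟨k, hk, hkl⟩
          rw [hinj hkl] at hk
          exact absurd hl (not_lt.2 hk.1)

lemma nsfIter_noiseSet_of_forall_right (hf : IsLevel G f) (hb : IsSupportSequence G b) {i : Fin n}
    (hright : ∀ l, i ≤ l → b l ∈ rightSet G l) (β : Bool) :
    nsfIter G b (noiseSet G (Sum.inl i) true β) n =
      (insert (b i) ((Ioi i).image b)).map .inr := by
  have hinj := support_injective hf hb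
  have hi := i.2
  obtain ⟨m, hm⟩ : ∃ m : Fin n, (m : ℕ) + 1 = n := ⟨⟨n - 1, by omega⟩, by simp only; omega⟩
  have h := nsfIter_noiseSet_of_right hf hb i β m (by omega) m.2 fun l hil _ => hright l hil
  have him : i ≤ m := Fin.le_def.2 (by omega)
  rw [Fin.eta, nbrs_support_of_right hf hb (hright m him), hm] at h
  rw [h]
  ext v
  rcases v with j | c
  · have := j.2
    simp [mem_symmDiff]
    omega
  · rw [← image_insert, Ioi_insert]
    simp only [mem_symmDiff, mem_map, Function.Embedding.inr_apply, Sum.inr.injEq,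
      exists_eq_right, mem_insert, mem_image, mem_Ico, mem_Ici, Function.Embedding.inl_apply,
      reduceCtorEq, and_false, exists_false, or_false]
    constructor
    · rintro (⟨⟨l, hl, rfl⟩, -⟩ | ⟨rfl, -⟩)
      · exact ⟨l, hl.1, rfl⟩
      · exact ⟨m, him, rfl⟩
    · rintro ⟨l, hl, rfl⟩
      by_cases hlm : l = m
      · subst hlm
        exact Or.inr ⟨rfl, fun ⟨k, hk, hkl⟩ => hk.2.ne (hinj hkl)⟩
      · have hlt : l < m := by
          have := l.2
          rw [Fin.ext_iff] at hlm
          exact Fin.lt_def.2 (by omega)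
        exact Or.inl ⟨⟨l, ⟨hl, hlt⟩, rfl⟩, fun h' => hlm (hinj h')⟩

end Final

end

end NoisyGTL

theorem mainTheorem4 {n : ℕ} {C : Type*} [Fintype C] [DecidableEq C]
    (κ : ℕ) (hκ : 2 ≤ κ)
    (G : SimpleGraph (Fin n ⊕ C)) (hG : IsGTL G (2 * κ) κ)
    (b : Fin n → C) (hb : IsSupportSequence G b)
    (last : Fin n) (hlast : (last : ℕ) + 1 = n)
    (p : Fin n ⊕ C → ℝ) :
    -- the noiseless post-measurement state, and the separate update of the local channels
    (∀ s : Fin n → Fin 2,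
      rollOp G b s * graphState G * (rollOp G b s)ᴴ =
          (1 / 2 : ℂ) ^ n • graphState (finalGraph G b) ∧
      ∀ l : List (Fin n ⊕ C),
        rollOp G b s * l.foldr (fun v ρ => depol v (p v) ρ) (graphState G) * (rollOp G b s)ᴴ =
          l.foldr (fun v ρ => updatedMap G b v (p v) ρ)
            (rollOp G b s * graphState G * (rollOp G b s)ᴴ)) ∧
    -- peer qubits
    (∀ c : C, (∃ m, c = b m) ∨ c ∈ rolledSet G b last ∨ ∃ m, c ∈ nonSupport G b m) ∧
    (∀ (m : Fin n) (ρ : Op C),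
      updatedMap G b (Sum.inr (b m)) (p (Sum.inr (b m))) ρ =
        peerMixture (b m) (rolledSet G b last ∪ nonSupport G b m) (p (Sum.inr (b m))) ρ) ∧
    (∀ c ∈ rolledSet G b last, ∀ ρ : Op C,
      updatedMap G b (Sum.inr c) (p (Sum.inr c)) ρ =
        peerMixture c (Finset.univ.image b) (p (Sum.inr c)) ρ) ∧
    (∀ (m : Fin n), ∀ c ∈ nonSupport G b m, ∀ ρ : Op C,
      updatedMap G b (Sum.inr c) (p (Sum.inr c)) ρ =
        peerMixture c {b m} (p (Sum.inr c)) ρ) ∧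
    -- orchestration qubits: right supports from `o_i` on, or a first left support at `o_m`
    (∀ i : Fin n, (∀ l : Fin n, i ≤ l → b l ∈ rightSet G l) → ∀ ρ : Op C,
      updatedMap G b (Sum.inl i) (p (Sum.inl i)) ρ =
        orchMixture (b i) ((Finset.Ioi i).image b) (p (Sum.inl i)) ρ) ∧
    (∀ i m : Fin n, i ≤ m → (∀ l : Fin n, i ≤ l → l < m → b l ∈ rightSet G l) →
      b m ∉ rightSet G m → ∀ ρ : Op C,
      updatedMap G b (Sum.inl i) (p (Sum.inl i)) ρ =
        orchMixture (b m) ((Finset.Iio i).image b) (p (Sum.inl i)) ρ) := by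
  obtain ⟨f, hf⟩ := exists_isLevel_of_isGTL hG
  have hinj := support_injective hf hb
  refine ⟨fun s => ⟨?_, fun l => rollMap_foldr_depol hb s p l⟩, peer_classification hf hb hlast,
    fun m ρ => ?_, fun c hc ρ => ?_, fun m c hc ρ => ?_, fun i hi ρ => ?_,
    fun i m him hi hm ρ => ?_⟩
  · have h := rollMap_stringState hb s ∅
    have h0 : nsfIter G b ∅ n = ∅ :=
      nsfIter_eq_of_supports (M := ∅) hinj ∅ (t := 0) (by simp) rfl n (Nat.zero_le n)
    have h1 : (∅ : Finset (Fin n ⊕ C)).toRight = ∅ := rfl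
    rw [h0, stringState_empty, h1, stringState_empty] at h
    exact h
  · rw [updatedMap_inr hb, nbrs_finalGraph_support hf hb hlast]
  · rw [updatedMap_inr hb, nbrs_finalGraph_rolled hf hb hlast hc]
  · rw [updatedMap_inr hb, nbrs_finalGraph_nonSupport hf hb hc]
  · refine updatedMap_inl hb i ?_ (nsfIter_noiseSet_of_forall_right hf hb hi) _ ρ
    simp [hinj.eq_iff]
  · refine updatedMap_inl hb i ?_ (nsfIter_noiseSet_of_left hf hb him hi hm) _ ρ
    simp [hinj.eq_iff, him]
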